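/- All logarithms are in base $2$. Definitions. A finite metric space $(X,d)$ has doubling dimension (at most) $\mathrm{ddim}\in\mathbb R$ if for every $r>0$ every closed ball of radius $2r$ can be covered by at most $2^{\mathrm{ddim}}$ closed balls of radius $r$ (with centers in $X$). For a weighted graph $H$ over $X$, $d_H$ is its shortest path distance ($\infty$ between different components) and $w(H)$ is the sum of its edge weights; $H$ is dominating if $d\le d_H$; its size is its number of edges, and its lightness is $w(H)/w(\mathrm{MST}(X))$, where $\mathrm{MST}(X)$ is a minimum spanning tree of $X$. An oblivious $\nu$-reliable $t$-spanner of $X$ is a discrete probability distribution $\mathcal D$ over dominating weighted graphs over $X$ such that for every attack set $B\subseteq X$ there are sets $B_H^+\supseteq B$ ($H\in\mathrm{supp}(\mathcal D)$) such that $d_{H[X\setminus B]}(x,y)\le t\cdot d(x,y)$ for all $H\in\mathrm{supp}(\mathcal D)$ and all $x,y\notin B_H^+$, and $\mathbb E_{H\sim\mathcal D}[|B_H^+|]\le(1+\nu)|B|$. It has size $m$ and lightness $\phi$ if every $H\in\mathrm{supp}(\mathcal D)$ has at most $m$ edges and lightness at most $\phi$. Corollary. (1) There is a universal constant $C>0$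 such that for all $\epsilon,\nu\in(0,1/16)$, every metric space with $n\ge 3$ points and doubling dimension $\mathrm{ddim}$ admits an oblivious $\nu$-reliable $(1+\epsilon)$-spanner of size at most $$n\cdot\epsilon^{-C\,\mathrm{ddim}}\cdot f\!\left(\nu^{-1}\log\log n\right)^2$$ and lightness at most $$\epsilon^{-C\,\mathrm{ddim}}\cdot f\!\left(\nu^{-2}\log n\right),$$ where $f(s)=C\,s\,(\log s)^{C}$. That is, the size is $n\,\epsilon^{-O(\mathrm{ddim})}\,\tilde O(\nu^{-1}\log\log n)^2$ and the lightness is $\epsilon^{-O(\mathrm{ddim})}\,\tilde O(\nu^{-2}\log n)$. (2) For bounded doubling dimension and constant $\epsilon$ the lightness bound is tight up to lower-order terms: for every $n$ the shortest path metric of the unweighted path $P_n$ on $n$ vertices has doubling dimension at most $\log 3$, and there is a universal constant $c>0$ such that for all $\nu\in(0,1/16)$, all $n\ge2$ and every finite $t$, if an oblivious $\nu$-reliable $t$-spanner of $P_n$ has lightness $\phi$, then $\phi\ge c\,\nu^{-2}\log(\nu n)$. -/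

import Mathlib

open scoped NNReal ENNReal

noncomputable section

/-- A (simple, undirected) graph over the point set `X` with nonnegative edge weights.
The weight function is only ever evaluated on edges of the graph. -/
structure WeightedGraph (X : Type*) where
  graph : SimpleGraph X
  weight : Sym2 X → ℝ≥0

namespace WeightedGraph

variable {X : Type*}

/-- The induced weighted subgraph `H[s]`. -/
def induce (H : WeightedGraph X) (s : Set X) : WeightedGraph s where
  graph := H.graph.induce s
  weight e := H.weight (e.map Subtype.val)

/-- The length of a walk: the sum of the weights of its edges. -/
def walkLength (H : WeightedGraph X) {x y : X} (p : H.graph.Walk x y) : ℝ≥0 :=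
  (p.edges.map H.weight).sum

/-- The shortest path distance `d_H(x, y)`; it is `∞` if `x` and `y` are not connected. -/
def pathDist (H : WeightedGraph X) (x y : X) : ℝ≥0∞ :=
  ⨅ p : H.graph.Walk x y, (H.walkLength p : ℝ≥0∞)

/-- The number of edges. -/
def size (H : WeightedGraph X) : ℕ := H.graph.edgeSet.ncard

/-- The weight `w(H)`: the sum of the weights of all edges. -/
def totalWeight (H : WeightedGraph X) : ℝ := ∑ᶠ e ∈ H.graph.edgeSet, (H.weight e : ℝ)

/-- A graph over a metric space, each edge weighted by the distance of its endpoints. -/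
def ofMetric [MetricSpace X] (G : SimpleGraph X) : WeightedGraph X where
  graph := G
  weight := Sym2.lift ⟨fun x y => nndist x y, fun x y => nndist_comm x y⟩

end WeightedGraph

/-- The weight of a minimum spanning tree of a (finite, nonempty) metric space. -/
def mstWeight (X : Type*) [MetricSpace X] : ℝ :=
  ⨅ T : {T : SimpleGraph X // T.IsTree}, (WeightedGraph.ofMetric T.1).totalWeight

/-- The lightness `w(H) / w(MST(X))`. -/
def WeightedGraph.lightness {X : Type*} [MetricSpace X] (H : WeightedGraph X) : ℝ :=
  H.totalWeight / mstWeight X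

/-- `d_H` dominates the metric of `X`. -/
def WeightedGraph.Dominates {X : Type*} [MetricSpace X] (H : WeightedGraph X) : Prop :=
  ∀ x y : X, edist x y ≤ H.pathDist x y

/-- `X` has doubling dimension (at most) `ddim`: for every `r > 0`, every closed ball of radius
`2r` can be covered by at most `2 ^ ddim` closed balls of radius `r`. -/
def HasDoublingDimension (X : Type*) [MetricSpace X] (ddim : ℝ) : Prop :=
  ∀ r : ℝ, 0 < r → ∀ x : X, ∃ S : Finset X, (S.card : ℝ) ≤ (2 : ℝ) ^ ddim ∧
    Metric.closedBall x (2 * r) ⊆ ⋃ c ∈ S, Metric.closedBall c r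

/-- The distribution `D` over weighted graphs is an oblivious `ν`-reliable `t`-spanner of `X`:
every graph in the support is dominating, and for every attack set `B` there are faulty
extensions `Bp H ⊇ B`, one for each `H` in the support, such that distances between points
outside `Bp H` are preserved up to the factor `t` in `H[X \ B]`, and the expected size of
`Bp H` is at most `(1 + ν) |B|`. -/
def IsObliviousReliableSpanner {X : Type*} [MetricSpace X] [Fintype X]
    (D : PMF (WeightedGraph X)) (ν t : ℝ) : Prop :=
  (∀ H ∈ D.support, H.Dominates) ∧
  ∀ B : Finset X, ∃ Bp : WeightedGraph X → Finset X,
    (∀ H ∈ D.support, B ⊆ Bp H ∧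
      ∀ x y : {z : X | z ∉ B}, x.1 ∉ Bp H → y.1 ∉ Bp H →
        (H.induce {z : X | z ∉ B}).pathDist x y ≤ ENNReal.ofReal (t * dist x.1 y.1)) ∧
    ∑' H, D H * ((Bp H).card : ℝ≥0∞) ≤ ENNReal.ofReal ((1 + ν) * B.card)

/-- Every graph in the support of `D` has at most `m` edges. -/
def HasSizeAtMost {X : Type*} (D : PMF (WeightedGraph X)) (m : ℝ) : Prop :=
  ∀ H ∈ D.support, (H.size : ℝ) ≤ m

/-- Every graph in the support of `D` has lightness at most `φ`. -/
def HasLightnessAtMost {X : Type*} [MetricSpace X] (D : PMF (WeightedGraph X)) (φ : ℝ) : Prop :=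
  ∀ H ∈ D.support, H.lightness ≤ φ

/-- `C · s · (log₂ s) ^ C`, the bound that `Õ(s)` stands for when its hidden constants are `C`. -/
def softO (C s : ℝ) : ℝ := C * s * (Real.logb 2 s) ^ C

/-- The `n` vertices of the unweighted path graph `P_n`. -/
def PathMetric (n : ℕ) : Type := Fin n

instance (n : ℕ) : Fintype (PathMetric n) := inferInstanceAs (Fintype (Fin n))

/-- The shortest path metric of the unweighted path: `d(i, j) = |i - j|`. -/
instance (n : ℕ) : MetricSpace (PathMetric n) :=
  MetricSpace.induced (fun i : Fin n => ((i : ℕ) : ℝ))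
    (fun _ _ h => Fin.ext (Nat.cast_injective h)) inferInstance

end

/-! Construction. Take nested nets with scales `δ * 2 ^ i`. Points with the same ancestor at level
`i` form a cluster, and all clusters form a laminar family. Each cluster receives random
representatives. All representatives of two clusters are joined when their net points are within `2
^ m` scales, where `2 ^ m` is about `1 / ε`, and when one cluster is the parent of the other. If
every cluster of `x` and of `y` has an unattacked representative, a route climbs from `x` through
representatives to a scale of about `ε * dist x y`, crosses over and descends to `y`. The detour is
a geometric sum, at most `ε * dist x y` (`pathDist_spanner_le`).

Reliability. There may be far more levels than `log n`, so a union bound over levels is useless.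
Instead a cluster takes its samples from its base, the smallest cluster inside it whose size agrees
with its own up to a factor `1 + γ`. By laminarity a point lies in at most one base of each size
class, hence in about `γ⁻¹ log n` bases. Clusters whose base is attacked almost entirely cover at
most `|B| / (1 - 2γ)` points. Any other base `D` loses all its `s + 1` samples with probability at
most `(1 - γ) ^ s * |B ∩ D| / |D|` and then spoils at most `(1 + γ) |D|` points. Summing `|B ∩ D|`
over the bases costs only the number of bases at a point (`sum_card_faulty_le`). Therefore `γ = ν /
8` and `s` of order `ν⁻¹ log (ν⁻² log n)` suffice, which is where `log log n` comes from.

Cost. Each pair joined at level `i` is charged to a net point that disappears within `m` levels;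
doubling bounds the charge, and each point pays at `m` levels only, so the size is linear in `n`. A
separated set with at least two points bounds the spanning tree from below
(`card_mul_le_mstWeight`), so a level weighs a constant number of spanning trees up to the factors
in `s` and `ε`. Only the top `log n` levels matter, since the levels below decay geometrically
(`sum_le_of_le_geometric`).

Lower bound. Cut the path into windows of length `w`, let each window survive independently with
probability `q = 4ν`, and attack the rest. Reliability forces about `3νn` vertices to stay
connected, so, up to one window, each of them has an edge from its window to another surviving
window. Two given windows survive together with probability `q ^ 2` only, so the windows at distance
at most `k ≈ 1 / (16ν)` account for at most `2νn` of these vertices. The others need of order `n /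
(νw)` edges of length more than `kw`, hence weight of order `n / ν ^ 2`. This holds at every dyadic
`w` up to `νn / 2`, and an edge is charged at most twice its length over all scales, so the `log
(νn)` scales add up. Averaging produces one graph that is bad at all scales simultaneously
(`exists_le_sum_card_farPairs`). -/

namespace WeightedGraph

variable {X : Type*}

/-! ### Path distance and total weight -/

theorem walkLength_nil (H : WeightedGraph X) (x : X) :
    H.walkLength (SimpleGraph.Walk.nil : H.graph.Walk x x) = 0 := by
  simp [walkLength]

theorem walkLength_cons (H : WeightedGraph X) {x y z : X} (h : H.graph.Adj x y)
    (p : H.graph.Walk y z) :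
    H.walkLength (SimpleGraph.Walk.cons h p) = H.weight s(x, y) + H.walkLength p := by
  simp [walkLength]

theorem walkLength_append (H : WeightedGraph X) {x y z : X} (p : H.graph.Walk x y)
    (q : H.graph.Walk y z) :
    H.walkLength (p.append q) = H.walkLength p + H.walkLength q := by
  simp [walkLength, SimpleGraph.Walk.edges_append]

theorem pathDist_self (H : WeightedGraph X) (x : X) : H.pathDist x x = 0 := by
  refine le_antisymm ?_ zero_le
  exact (iInf_le _ SimpleGraph.Walk.nil).trans (by simp [walkLength_nil])

theorem pathDist_le_weight (H : WeightedGraph X) {x y : X} (h : H.graph.Adj x y) :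
    H.pathDist x y ≤ H.weight s(x, y) :=
  (iInf_le _ (SimpleGraph.Walk.cons h SimpleGraph.Walk.nil)).trans
    (by simp [walkLength_nil, walkLength_cons])

theorem pathDist_triangle (H : WeightedGraph X) (x y z : X) :
    H.pathDist x z ≤ H.pathDist x y + H.pathDist y z := by
  unfold pathDist
  rw [ENNReal.iInf_add]
  refine le_iInf fun p => ?_
  rw [ENNReal.add_iInf]
  refine le_iInf fun q => ?_
  refine (iInf_le _ (p.append q)).trans ?_
  rw [walkLength_append]; push_cast; exact le_rfl

theorem pathDist_comm (H : WeightedGraph X) (x y : X) : H.pathDist x y = H.pathDist y x := by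
  have key : ∀ x y, H.pathDist x y ≤ H.pathDist y x := fun x y => by
    refine le_iInf fun p => (iInf_le _ p.reverse).trans ?_
    simp [walkLength, SimpleGraph.Walk.edges_reverse, List.sum_reverse]
  exact le_antisymm (key x y) (key y x)

theorem exists_walk_of_pathDist_lt_top (H : WeightedGraph X) {x y : X}
    (h : H.pathDist x y < ⊤) : Nonempty (H.graph.Walk x y) := by
  by_contra hne
  rw [not_nonempty_iff] at hne
  simp [pathDist] at h

theorem totalWeight_eq_sum [Finite X] (H : WeightedGraph X) :
    H.totalWeight = ∑ e ∈ H.graph.edgeSet.toFinite.toFinset, (H.weight e : ℝ) := by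
  unfold totalWeight
  rw [finsum_mem_eq_finite_toFinset_sum]

theorem totalWeight_nonneg (H : WeightedGraph X) : 0 ≤ H.totalWeight :=
  finsum_nonneg fun _ => finsum_nonneg fun _ => NNReal.coe_nonneg _

variable [MetricSpace X]

theorem dist_le_walkLength_ofMetric (G : SimpleGraph X) {x y : X} (p : G.Walk x y) :
    nndist x y ≤ (ofMetric G).walkLength p := by
  induction p with
  | nil => simp
  | @cons u v w h p ih =>
    refine (nndist_triangle u v w).trans ?_
    exact (add_le_add_right ih _).trans (walkLength_cons (ofMetric G) h p).ge

theorem ofMetric_dominates (G : SimpleGraph X) : (ofMetric G).Dominates := fun x y =>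
  le_iInf fun p => by
    rw [edist_nndist]; exact_mod_cast dist_le_walkLength_ofMetric G p

theorem Dominates.dist_le_weight {H : WeightedGraph X} (hH : H.Dominates) {x y : X}
    (h : H.graph.Adj x y) : dist x y ≤ H.weight s(x, y) := by
  have := (hH x y).trans (H.pathDist_le_weight h)
  rw [edist_nndist, ENNReal.coe_le_coe] at this
  exact_mod_cast this

theorem pathDist_induce_ofMetric_le (G : SimpleGraph X) (s : Set X) {x y : s}
    (h : G.Adj x y) : ((ofMetric G).induce s).pathDist x y ≤ ENNReal.ofReal (dist x.1 y.1) := by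
  have h' : ((ofMetric G).induce s).graph.Adj x y := h
  refine (pathDist_le_weight _ h').trans ?_
  rw [← edist_dist, edist_nndist]
  exact le_rfl

end WeightedGraph

/-! ### Spanning trees and separated sets -/

theorem exists_isTree (X : Type*) [Fintype X] [Nonempty X] :
    Nonempty {T : SimpleGraph X // T.IsTree} := by
  obtain ⟨T, -, hT⟩ := (SimpleGraph.connected_top (V := X)).exists_isTree_le
  exact ⟨⟨T, hT⟩⟩

/-- A spanning connected graph is at least as heavy as half the separation of a separated set
times its cardinality. -/
theorem card_mul_le_totalWeight {X : Type*} [MetricSpace X] [Fintype X] (G : SimpleGraph X)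
    (hG : G.Connected) (S : Finset X) (r : ℝ) (hr : 0 ≤ r) (hS : 2 ≤ S.card)
    (hsep : ∀ p ∈ S, ∀ q ∈ S, p ≠ q → r ≤ dist p q) :
    S.card * r / 2 ≤ (WeightedGraph.ofMetric G).totalWeight := by
  classical
  -- Hats of height `r / 2` around the points of `S`, with disjoint supports. A path in `G` from `p`
  -- to another point of `S` sees the hat of `p` drop from `r / 2` to `0`, while on each edge all
  -- hats together vary by at most its length.
  set f : X → X → ℝ := fun p x => max 0 (r / 2 - dist x p) with hf
  have hsupp : ∀ p ∈ S, ∀ q ∈ S, ∀ x, 0 < f p x → 0 < f q x → p = q := by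
    intro p hp q hq x h1 h2
    by_contra hne
    have := hsep p hp q hq hne
    have t := dist_triangle_left p q x
    simp only [hf, lt_max_iff, lt_irrefl, false_or] at h1 h2
    linarith
  have hnn : ∀ p x, 0 ≤ f p x := fun p x => le_max_left _ _
  have hlip : ∀ p x y, f p x - f p y ≤ dist x y := by
    intro p x y
    have t := dist_triangle y x p
    rw [dist_comm y x] at t
    simp only [hf, sub_le_iff_le_add]
    refine max_le (by have := le_max_left 0 (r / 2 - dist y p); positivity) ?_
    have := le_max_right 0 (r / 2 - dist y p)
    linarith
  have hedge : ∀ x y, ∑ p ∈ S, |f p x - f p y| ≤ dist x y := by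
    intro x y
    have hone : ∀ x, (∀ p ∈ S, f p x = 0) ∨ ∃ p ∈ S, 0 < f p x ∧ ∀ q ∈ S, q ≠ p → f q x = 0 := by
      intro x
      by_cases h : ∀ p ∈ S, f p x = 0
      · exact Or.inl h
      · push Not at h
        obtain ⟨p, hp, hpx⟩ := h
        have hpx' := lt_of_le_of_ne (hnn p x) (Ne.symm hpx)
        refine Or.inr ⟨p, hp, hpx', fun q hq hqp => ?_⟩
        by_contra hqx
        exact hqp (hsupp q hq p hp x (lt_of_le_of_ne (hnn q x) (Ne.symm hqx)) hpx')
    have habs : ∀ p, |f p x - f p y| ≤ dist x y := fun p =>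
      abs_sub_le_iff.2 ⟨hlip p x y, by rw [dist_comm]; exact hlip p y x⟩
    rcases hone x with hx | ⟨p, hp, hpx, hx⟩
    · rcases hone y with hy | ⟨q, hq, hqy, hy⟩
      · rw [Finset.sum_eq_zero fun p hp => by rw [hx p hp, hy p hp]; simp]; exact dist_nonneg
      · rw [Finset.sum_eq_single_of_mem q hq fun b hb hne => by rw [hx b hb, hy b hb hne]; simp]
        exact habs q
    · rcases hone y with hy | ⟨q, hq, hqy, hy⟩
      · rw [Finset.sum_eq_single_of_mem p hp fun b hb hne => by rw [hx b hb hne, hy b hb]; simp]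
        exact habs p
      · by_cases hpq : p = q
        · subst hpq
          rw [Finset.sum_eq_single_of_mem p hp fun b hb hne => by
            rw [hx b hb hne, hy b hb hne]; simp]
          exact habs p
        -- The endpoints lie under two different hats. The variations add up to `r - dist x p - dist
        -- y q`, which the separation of `p` and `q` bounds by `dist x y`.
        · rw [Finset.sum_eq_add_of_mem p q hp hq hpq fun b hb hne => by
            rw [hx b hb hne.1, hy b hb hne.2]; simp]
          rw [hx q hq (Ne.symm hpq), hy p hp hpq]
          have h1 : f p x = r / 2 - dist x p := by
            simp only [hf] at hpx ⊢
            exact max_eq_right (by by_contra h; rw [max_eq_left (by linarith)] at hpx; simp at hpx)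
          have h2 : f q y = r / 2 - dist y q := by
            simp only [hf] at hqy ⊢
            exact max_eq_right (by by_contra h; rw [max_eq_left (by linarith)] at hqy; simp at hqy)
          rw [sub_zero, zero_sub, abs_neg, abs_of_nonneg (hnn _ _), abs_of_nonneg (hnn _ _), h1, h2]
          have := hsep p hp q hq hpq
          have t1 := dist_triangle p x q
          have t2 := dist_triangle x y q
          rw [dist_comm p x] at t1
          linarith
  rw [WeightedGraph.totalWeight_eq_sum]
  set E := (WeightedGraph.ofMetric G).graph.edgeSet.toFinite.toFinset
  set g : X → Sym2 X → ℝ := fun p => Sym2.lift ⟨fun x y => |f p x - f p y|,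
    fun x y => abs_sub_comm _ _⟩ with hg
  have hgnn : ∀ p e, 0 ≤ g p e := fun p e => by
    induction e with | _ x y => exact abs_nonneg _
  have hpath : ∀ p (x y : X) (w : G.Walk x y), w.IsPath → f p x - f p y ≤ ∑ e ∈ E, g p e := by
    intro p x y w hw
    have h1 : ∀ {x y : X} (w : G.Walk x y), f p x - f p y ≤ (w.edges.map (g p)).sum := by
      intro x y w
      induction w with
      | nil => simp
      | @cons u v w h q ih =>
        simp only [SimpleGraph.Walk.edges_cons, List.map_cons, List.sum_cons]
        have : f p u - f p v ≤ g p s(u, v) := le_abs_self _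
        linarith
    refine (h1 w).trans ?_
    rw [← List.sum_toFinset _ hw.edges_nodup]
    refine Finset.sum_le_sum_of_subset_of_nonneg ?_ fun _ _ _ => hgnn _ _
    intro e he
    simp only [E, Set.Finite.mem_toFinset]
    exact w.edges_subset_edgeSet (by simpa using he)
  have hp : ∀ p ∈ S, r / 2 ≤ ∑ e ∈ E, g p e := by
    intro p hp
    obtain ⟨q, hq, hne⟩ := Finset.exists_mem_ne (by omega : 1 < S.card) p
    obtain ⟨w, hw⟩ := hG.exists_isPath p q
    have h := hpath p p q w hw
    have h1 : f p p = r / 2 := by simp [hf]; positivity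
    have h2 : f p q = 0 := by
      simp only [hf]
      exact max_eq_left (by linarith [hsep q hq p hp hne])
    linarith
  calc (S.card * r / 2 : ℝ) = ∑ p ∈ S, r / 2 := by rw [Finset.sum_const, nsmul_eq_mul]; ring
    _ ≤ ∑ p ∈ S, ∑ e ∈ E, g p e := Finset.sum_le_sum hp
    _ = ∑ e ∈ E, ∑ p ∈ S, g p e := Finset.sum_comm
    _ ≤ _ := Finset.sum_le_sum fun e _ => by
      induction e with | _ x y => exact hedge x y

theorem card_mul_le_mstWeight {X : Type*} [MetricSpace X] [Fintype X]
    (S : Finset X) (r : ℝ) (hr : 0 ≤ r) (hS : 2 ≤ S.card)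
    (hsep : ∀ p ∈ S, ∀ q ∈ S, p ≠ q → r ≤ dist p q) :
    S.card * r / 2 ≤ mstWeight X := by
  obtain ⟨p, hp⟩ := Finset.card_pos.1 (by omega : 0 < S.card)
  have : Nonempty X := ⟨p⟩
  have := exists_isTree X
  exact le_ciInf fun T => card_mul_le_totalWeight T.1 T.2.connected S r hr hS hsep

theorem mstWeight_pos (X : Type*) [MetricSpace X] [Fintype X] (h : 2 ≤ Fintype.card X) :
    0 < mstWeight X := by
  classical
  have : Nontrivial X := Fintype.one_lt_card_iff_nontrivial.1 h
  obtain ⟨x, y, hxy⟩ := exists_pair_ne X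
  have h1 := card_mul_le_mstWeight ({x, y} : Finset X) (dist x y) dist_nonneg
    (by rw [Finset.card_pair hxy]) (by
      intro p hp q hq hne
      simp only [Finset.mem_insert, Finset.mem_singleton] at hp hq
      rcases hp with rfl | rfl <;> rcases hq with rfl | rfl <;>
        first | exact absurd rfl hne | exact le_rfl | exact (dist_comm _ _).le)
  rw [Finset.card_pair hxy] at h1
  have := dist_pos.2 hxy
  push_cast at h1
  linarith

/-! ### Averaging over spanners and over random attacks -/

/-- By linearity the combination has expectation at most the right-hand side, and a random variable
cannot exceed its expectation on the whole support. A single graph can thus be tested against all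
scales and all attacks together. -/
theorem exists_mem_support_sum_le {α ι : Type*} (D : PMF α) (s : Finset ι) (c b : ι → ℝ)
    (hc : ∀ j ∈ s, 0 ≤ c j) (hb : ∀ j ∈ s, 0 ≤ b j) (f : ι → α → ℕ)
    (h : ∀ j ∈ s, ∑' H, D H * (f j H : ℝ≥0∞) ≤ ENNReal.ofReal (b j)) :
    ∃ H ∈ D.support, ∑ j ∈ s, c j * f j H ≤ ∑ j ∈ s, c j * b j := by
  by_contra! hcon
  set K := ∑ j ∈ s, c j * b j with hK
  have h1 : ∑' H, D H * ENNReal.ofReal (∑ j ∈ s, c j * f j H) ≤ ENNReal.ofReal K := by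
    have : ∀ H, D H * ENNReal.ofReal (∑ j ∈ s, c j * f j H) =
        ∑ j ∈ s, ENNReal.ofReal (c j) * (D H * (f j H : ℝ≥0∞)) := by
      intro H
      rw [ENNReal.ofReal_sum_of_nonneg fun j hj => mul_nonneg (hc j hj) (Nat.cast_nonneg _),
        Finset.mul_sum]
      refine Finset.sum_congr rfl fun j hj => ?_
      rw [ENNReal.ofReal_mul (hc j hj), ENNReal.ofReal_natCast]
      ring
    simp_rw [this]
    rw [Summable.tsum_finsetSum fun _ _ => ENNReal.summable, hK,
      ENNReal.ofReal_sum_of_nonneg fun j hj => mul_nonneg (hc j hj) (hb j hj)]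
    refine Finset.sum_le_sum fun j hj => ?_
    rw [ENNReal.tsum_mul_left, ENNReal.ofReal_mul (hc j hj)]
    exact mul_le_mul_right (h j hj) _
  have h2 : ∑' H, D H * ENNReal.ofReal K = ENNReal.ofReal K := by
    rw [ENNReal.tsum_mul_right, D.tsum_coe, one_mul]
  obtain ⟨H₀, hH₀⟩ := D.support_nonempty
  have hK0 : 0 ≤ K := Finset.sum_nonneg fun j hj => mul_nonneg (hc j hj) (hb j hj)
  have h3 : ∑' H, D H * ENNReal.ofReal K <
      ∑' H, D H * ENNReal.ofReal (∑ j ∈ s, c j * f j H) := by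
    refine ENNReal.tsum_lt_tsum (i := H₀) (by rw [h2]; exact ENNReal.ofReal_ne_top) ?_ ?_
    · intro H
      by_cases hH : H ∈ D.support
      · exact mul_le_mul_right (ENNReal.ofReal_le_ofReal (hcon H hH).le) _
      · rw [(D.apply_eq_zero_iff H).2 hH]; simp
    · refine ENNReal.mul_lt_mul_right ((D.mem_support_iff _).1 hH₀) (D.apply_ne_top _) ?_
      exact (ENNReal.ofReal_lt_ofReal_iff (hK0.trans_lt (hcon H₀ hH₀))).2 (hcon H₀ hH₀)
  rw [h2] at h3
  exact absurd h1 (not_le.2 h3)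

/-- The probability of the subset `A` of `I` if every element is kept independently with
probability `q`. -/
noncomputable def subsetWeight (I : Finset ℕ) (q : ℝ) (A : Finset ℕ) : ℝ :=
  (∏ _i ∈ A, q) * ∏ _i ∈ I \ A, (1 - q)

theorem subsetWeight_nonneg (I : Finset ℕ) {q : ℝ} (h0 : 0 ≤ q) (h1 : q ≤ 1) (A : Finset ℕ) :
    0 ≤ subsetWeight I q A :=
  mul_nonneg (Finset.prod_nonneg fun _ _ => h0) (Finset.prod_nonneg fun _ _ => sub_nonneg.2 h1)

theorem sum_subsetWeight (I T : Finset ℕ) (hT : T ⊆ I) (q : ℝ) :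
    ∑ A ∈ I.powerset, subsetWeight I q A * (if T ⊆ A then 1 else 0) = q ^ T.card := by
  -- Replacing `1 - q` by `0` at the elements of `T` removes from the expansion exactly the sets
  -- that do not contain `T`.
  have h := Finset.prod_add (fun _ : ℕ => q) (fun i => if i ∈ T then (0 : ℝ) else 1 - q) I
  have h1 : ∏ i ∈ I, (q + if i ∈ T then (0 : ℝ) else 1 - q) = q ^ T.card := by
    have : ∀ i ∈ I, (q + if i ∈ T then (0 : ℝ) else 1 - q) = if i ∈ T then q else 1 := by
      intro i _; split_ifs <;> ring
    rw [Finset.prod_congr rfl this, Finset.prod_ite_mem, Finset.inter_eq_right.2 hT,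
      Finset.prod_const]
  rw [← h1, h]
  refine Finset.sum_congr rfl fun A hA => ?_
  unfold subsetWeight
  split_ifs with hTA
  · rw [mul_one]
    congr 1
    refine Finset.prod_congr rfl fun i hi => ?_
    rw [if_neg fun hiT => (Finset.mem_sdiff.1 hi).2 (hTA hiT)]
  · obtain ⟨i, hiT, hiA⟩ := Finset.not_subset.1 hTA
    have h0 : ∏ i ∈ I \ A, (if i ∈ T then (0 : ℝ) else 1 - q) = 0 :=
      Finset.prod_eq_zero (Finset.mem_sdiff.2 ⟨hT hiT, hiA⟩) (if_pos hiT)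
    rw [h0, mul_zero, mul_zero]

theorem sum_subsetWeight_pair (I : Finset ℕ) {i j : ℕ} (hi : i ∈ I) (hj : j ∈ I) (hij : i ≠ j)
    (q : ℝ) :
    ∑ A ∈ I.powerset, subsetWeight I q A * (if i ∈ A ∧ j ∈ A then 1 else 0) = q ^ 2 := by
  have := sum_subsetWeight I {i, j} (by simp [Finset.insert_subset_iff, hi, hj]) q
  rw [Finset.card_pair hij] at this
  rw [← this]
  refine Finset.sum_congr rfl fun A _ => ?_
  simp [Finset.insert_subset_iff]

/-! ### The path: doubling dimension, spanning tree, windows -/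

namespace PathMetric

variable {n : ℕ}

/-- The position of a vertex of the path. -/
def pos (x : PathMetric n) : ℕ := Fin.val x

theorem pos_lt (x : PathMetric n) : x.pos < n := Fin.isLt x

theorem pos_injective : Function.Injective (pos (n := n)) := fun _ _ h => Fin.ext h

theorem dist_eq (x y : PathMetric n) : dist x y = |(x.pos : ℝ) - y.pos| := rfl

theorem card_eq (n : ℕ) : Fintype.card (PathMetric n) = n := Fintype.card_fin n

/-- Distances are integers: with `f = ⌊r⌋₊`, a ball of radius `2r` reaches at most `2f + 1` to each
side. Blocks of radius `f` around `x` and around the points `f + 1` to its left and right, clipped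
to the ends of the path, cover it. -/
theorem hasDoublingDimension (n : ℕ) : HasDoublingDimension (PathMetric n) (Real.logb 2 3) := by
  classical
  intro r hr x
  have hlt := x.pos_lt
  set f := ⌊r⌋₊ with hf
  have hf1 : (f : ℝ) ≤ r := Nat.floor_le hr.le
  have hf2 : r < f + 1 := Nat.lt_floor_add_one r
  let c₁ : PathMetric n := (⟨x.pos - (f + 1), by omega⟩ : Fin n)
  let c₂ : PathMetric n := (⟨min (x.pos + (f + 1)) (n - 1), by omega⟩ : Fin n)
  have e1 : c₁.pos = x.pos - (f + 1) := rfl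
  have e2 : c₂.pos = min (x.pos + (f + 1)) (n - 1) := rfl
  have hclose : ∀ y c : PathMetric n, y.pos ≤ c.pos + f → c.pos ≤ y.pos + f → dist y c ≤ r := by
    intro y c h1 h2
    refine le_trans ?_ hf1
    rw [dist_eq, abs_sub_le_iff]
    have h1' : (y.pos : ℝ) ≤ c.pos + f := by exact_mod_cast h1
    have h2' : (c.pos : ℝ) ≤ y.pos + f := by exact_mod_cast h2
    constructor <;> linarith
  refine ⟨{x, c₁, c₂}, ?_, ?_⟩
  · rw [Real.rpow_logb (by norm_num) (by norm_num) (by norm_num)]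
    exact_mod_cast Finset.card_le_three
  · intro y hy
    rw [Metric.mem_closedBall, dist_eq, abs_sub_le_iff] at hy
    have hylt := y.pos_lt
    have h1 : y.pos < x.pos + 2 * (f + 1) := by
      have : (y.pos : ℝ) < x.pos + 2 * (f + 1) := by linarith [hy.1]
      exact_mod_cast this
    have h2 : x.pos < y.pos + 2 * (f + 1) := by
      have : (x.pos : ℝ) < y.pos + 2 * (f + 1) := by linarith [hy.2]
      exact_mod_cast this
    simp only [Finset.mem_insert, Finset.mem_singleton, Set.mem_iUnion, Metric.mem_closedBall,
      exists_prop, exists_eq_or_imp, exists_eq_left]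
    by_cases hA : y.pos ≤ x.pos + f
    · by_cases hB : x.pos ≤ y.pos + f
      · exact Or.inl (hclose y x hA hB)
      · exact Or.inr (Or.inl (hclose y c₁ (by omega) (by omega)))
    · exact Or.inr (Or.inr (hclose y c₂ (by omega) (by omega)))

/-- A spanning tree of the path graph has fewer than `n` edges, all of length one. -/
theorem mstWeight_le (hn : 1 ≤ n) : mstWeight (PathMetric n) ≤ n := by
  classical
  obtain ⟨m, rfl⟩ : ∃ m, n = m + 1 := ⟨n - 1, by omega⟩
  obtain ⟨T, hT, hTree⟩ := (SimpleGraph.pathGraph_connected m).exists_isTree_le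
  have hbdd : BddBelow (Set.range fun T : {T : SimpleGraph (PathMetric (m + 1)) // T.IsTree} =>
      (WeightedGraph.ofMetric T.1).totalWeight) :=
    ⟨0, by rintro _ ⟨T, rfl⟩; exact WeightedGraph.totalWeight_nonneg _⟩
  refine (ciInf_le hbdd (⟨T, hTree⟩ : {T : SimpleGraph (PathMetric (m + 1)) // T.IsTree})).trans ?_
  rw [WeightedGraph.totalWeight_eq_sum]
  have hcard : (Set.toFinite T.edgeSet).toFinset.card ≤ m + 1 := by
    have h := hTree.card_edgeFinset
    have h' : (Set.toFinite T.edgeSet).toFinset = T.edgeFinset := by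
      ext e; simp
    rw [h']
    simp at h
    omega
  calc _ ≤ ∑ e ∈ (Set.toFinite T.edgeSet).toFinset, (1 : ℝ) := by
        refine Finset.sum_le_sum fun e he => ?_
        rw [Set.Finite.mem_toFinset] at he
        induction e with | _ x y =>
        have hadj := hT ((SimpleGraph.mem_edgeSet T).1 he)
        replace hadj := SimpleGraph.pathGraph_adj.1 hadj
        change dist (α := PathMetric (m + 1)) x y ≤ 1
        rw [dist_eq]
        rcases hadj with h | h
        · have : ((pos (n := m + 1) x : ℕ) : ℝ) + 1 = pos (n := m + 1) y := by exact_mod_cast h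
          rw [← this]; simp
        · have : ((pos (n := m + 1) y : ℕ) : ℝ) + 1 = pos (n := m + 1) x := by exact_mod_cast h
          rw [← this]; simp
    _ ≤ _ := by
        rw [Finset.sum_const, nsmul_eq_mul, mul_one]
        exact_mod_cast hcard

/-- The index of the window of length `w` that contains a vertex. -/
def win (w : ℕ) (x : PathMetric n) : ℕ := x.pos / w

theorem win_mem_range (w : ℕ) (x : PathMetric n) : x.win w ∈ Finset.range n :=
  Finset.mem_range.2 ((Nat.div_le_self _ _).trans_lt x.pos_lt)

theorem card_win_eq_le {w : ℕ} (hw : 1 ≤ w) (i : ℕ) :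
    (Finset.univ.filter fun x : PathMetric n => x.win w = i).card ≤ w := by
  have : (Finset.univ.filter fun x : PathMetric n => x.win w = i).card ≤
      (Finset.Ico (i * w) (i * w + w)).card := by
    refine Finset.card_le_card_of_injOn pos ?_ pos_injective.injOn
    intro x hx
    have hx : x.pos / w = i := (Finset.mem_filter.1 hx).2
    rw [Nat.div_eq_iff (by omega)] at hx
    simp only [Finset.coe_Ico, Set.mem_Ico]
    omega
  simpa using this

open Classical in
/-- The edges of `G`, oriented to the right, that skip at least `k` windows of length `w`. -/
noncomputable def farPairs (G : SimpleGraph (PathMetric n)) (w k : ℕ) :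
    Finset (PathMetric n × PathMetric n) :=
  Finset.univ.filter fun p => G.Adj p.1 p.2 ∧ p.1.win w + k < p.2.win w

theorem mem_farPairs {G : SimpleGraph (PathMetric n)} {w k : ℕ}
    {p : PathMetric n × PathMetric n} :
    p ∈ farPairs G w k ↔ G.Adj p.1 p.2 ∧ p.1.win w + k < p.2.win w := by
  simp [farPairs]

/-- The vertices in surviving windows whose window has an edge to another surviving window. -/
def Touches (G : SimpleGraph (PathMetric n)) (w : ℕ) (A : Finset ℕ) (x : PathMetric n) : Prop :=
  x.win w ∈ A ∧ ∃ a b, G.Adj a b ∧ a.win w = x.win w ∧ b.win w ≠ x.win w ∧ b.win w ∈ A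

/-- The windows other than `i` at distance at most `k` from it. -/
def nearWindows (n k i : ℕ) : Finset ℕ :=
  (Finset.range n).filter fun j => j ≠ i ∧ j ≤ i + k ∧ i ≤ j + k

theorem card_nearWindows_le (n k i : ℕ) : (nearWindows n k i).card ≤ 2 * k := by
  have hsub : nearWindows n k i ⊆ (Finset.Icc (i - k) (i + k)).erase i := by
    intro j hj
    simp only [nearWindows, Finset.mem_filter] at hj
    simp only [Finset.mem_erase, Finset.mem_Icc]
    omega
  refine (Finset.card_le_card hsub).trans ?_
  rw [Finset.card_erase_of_mem (by simp)]
  simp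
  omega

-- Two distinct windows survive together with probability `q ^ 2`. Each vertex has at most `2k` near
-- windows, and a far edge can only affect the vertices of its two end windows, at most `2w` of
-- them.
open Classical in
theorem sum_subsetWeight_card_touches_le (G : SimpleGraph (PathMetric n)) {w : ℕ} (hw : 1 ≤ w)
    (k : ℕ) {q : ℝ} (h0 : 0 ≤ q) (h1 : q ≤ 1) :
    ∑ A ∈ (Finset.range n).powerset, subsetWeight (Finset.range n) q A *
      (Finset.univ.filter (Touches G w A)).card ≤
      2 * k * n * q ^ 2 + 2 * w * (farPairs G w k).card * q ^ 2 := by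
  set I := Finset.range n
  have key : ∀ A x, (if Touches G w A x then (1 : ℝ) else 0) ≤
      ∑ j ∈ nearWindows n k (x.win w), (if x.win w ∈ A ∧ j ∈ A then (1 : ℝ) else 0) +
      ∑ p ∈ farPairs G w k, ((if p.1.win w = x.win w then (1 : ℝ) else 0) +
        (if p.2.win w = x.win w then 1 else 0)) *
          (if p.1.win w ∈ A ∧ p.2.win w ∈ A then 1 else 0) := by
    intro A x
    have n1 : ∀ j ∈ nearWindows n k (x.win w),
        0 ≤ (if x.win w ∈ A ∧ j ∈ A then (1 : ℝ) else 0) := fun j _ => by positivity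
    have n2 : ∀ p ∈ farPairs G w k, 0 ≤ ((if p.1.win w = x.win w then (1 : ℝ) else 0) +
        (if p.2.win w = x.win w then 1 else 0)) *
          (if p.1.win w ∈ A ∧ p.2.win w ∈ A then 1 else 0) := fun p _ => by positivity
    split_ifs with h
    · obtain ⟨hx, a, b, hab, ha, hb, hbA⟩ := h
      by_cases hn : b.win w ∈ nearWindows n k (x.win w)
      · have := Finset.single_le_sum n1 hn
        rw [if_pos ⟨hx, hbA⟩] at this
        linarith [Finset.sum_nonneg n2]
      · have hb' := b.win_mem_range w
        simp only [nearWindows, Finset.mem_filter, hb', true_and] at hn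
        by_cases hlt : a.win w < b.win w
        · have hm : (a, b) ∈ farPairs G w k := mem_farPairs.2 ⟨hab, by dsimp only; omega⟩
          have := Finset.single_le_sum n2 hm
          simp only [ha, hx, hbA, and_self, if_true, mul_one] at this
          have n3 : (0 : ℝ) ≤ if b.win w = x.win w then 1 else 0 := by positivity
          linarith [Finset.sum_nonneg n1]
        · have hm : (b, a) ∈ farPairs G w k := mem_farPairs.2 ⟨hab.symm, by dsimp only; omega⟩
          have := Finset.single_le_sum n2 hm
          simp only [ha, hx, hbA, and_self, if_true, mul_one] at this
          have n3 : (0 : ℝ) ≤ if b.win w = x.win w then 1 else 0 := by positivity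
          linarith [Finset.sum_nonneg n1]
    · exact add_nonneg (Finset.sum_nonneg n1) (Finset.sum_nonneg n2)
  calc _ = ∑ A ∈ I.powerset, ∑ x, subsetWeight I q A * (if Touches G w A x then (1 : ℝ) else 0) := by
        refine Finset.sum_congr rfl fun A _ => ?_
        rw [← Finset.mul_sum, Finset.sum_boole]
    _ ≤ ∑ A ∈ I.powerset, ∑ x : PathMetric n, subsetWeight I q A *
        (∑ j ∈ nearWindows n k (x.win w), (if x.win w ∈ A ∧ j ∈ A then (1 : ℝ) else 0) +
      ∑ p ∈ farPairs G w k, ((if p.1.win w = x.win w then (1 : ℝ) else 0) +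
        (if p.2.win w = x.win w then 1 else 0)) *
          (if p.1.win w ∈ A ∧ p.2.win w ∈ A then 1 else 0)) := by
        refine Finset.sum_le_sum fun A _ => Finset.sum_le_sum fun x _ => ?_
        exact mul_le_mul_of_nonneg_left (key A x) (subsetWeight_nonneg _ h0 h1 _)
    _ = ∑ x : PathMetric n, (∑ j ∈ nearWindows n k (x.win w), ∑ A ∈ I.powerset,
          subsetWeight I q A * (if x.win w ∈ A ∧ j ∈ A then (1 : ℝ) else 0)) +
        ∑ p ∈ farPairs G w k, ∑ x : PathMetric n, ((if p.1.win w = x.win w then (1 : ℝ) else 0) +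
        (if p.2.win w = x.win w then 1 else 0)) * ∑ A ∈ I.powerset, subsetWeight I q A *
          (if p.1.win w ∈ A ∧ p.2.win w ∈ A then 1 else 0) := by
        rw [Finset.sum_comm]
        simp_rw [mul_add, Finset.sum_add_distrib, Finset.mul_sum]
        congr 1
        · exact Finset.sum_congr rfl fun x _ => Finset.sum_comm
        · rw [Finset.sum_comm (s := farPairs G w k)]
          refine Finset.sum_congr rfl fun x _ => ?_
          rw [Finset.sum_comm]
          refine Finset.sum_congr rfl fun p _ => Finset.sum_congr rfl fun A _ => by ring
    _ ≤ ∑ x : PathMetric n, 2 * k * q ^ 2 + ∑ p ∈ farPairs G w k, 2 * w * q ^ 2 := by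
        refine add_le_add (Finset.sum_le_sum fun x _ => ?_) (Finset.sum_le_sum fun p hp => ?_)
        · have hpair : ∀ j ∈ nearWindows n k (x.win w), ∑ A ∈ I.powerset,
              subsetWeight I q A * (if x.win w ∈ A ∧ j ∈ A then (1 : ℝ) else 0) = q ^ 2 := by
            intro j hj
            have hj' := Finset.mem_filter.1 hj
            exact sum_subsetWeight_pair I (x.win_mem_range w) hj'.1 hj'.2.1.symm q
          rw [Finset.sum_congr rfl hpair, Finset.sum_const, nsmul_eq_mul]
          refine mul_le_mul_of_nonneg_right ?_ (by positivity)
          exact_mod_cast card_nearWindows_le n k _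
        · have hp' := mem_farPairs.1 hp
          rw [← Finset.sum_mul, sum_subsetWeight_pair I (p.1.win_mem_range w)
            (p.2.win_mem_range w) (by omega) q, Finset.sum_add_distrib]
          refine mul_le_mul_of_nonneg_right ?_ (by positivity)
          rw [Finset.sum_boole, Finset.sum_boole, two_mul]
          have hcount : ∀ i : ℕ,
              ((Finset.univ.filter fun x : PathMetric n => i = x.win w).card : ℝ) ≤ w := by
            intro i
            simp_rw [fun x : PathMetric n => eq_comm (a := i) (b := x.win w)]
            exact_mod_cast card_win_eq_le hw i
          exact add_le_add (hcount _) (hcount _)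
    _ = _ := by
        rw [Finset.sum_const, Finset.sum_const, nsmul_eq_mul, nsmul_eq_mul, Finset.card_univ,
          card_eq]
        ring

end PathMetric

/-! ### Random window attacks force many long edges -/

namespace PathMetric

variable {n : ℕ}

/-- The vertices outside the windows in `A`. -/
def windowAttack (n w : ℕ) (A : Finset ℕ) : Finset (PathMetric n) :=
  Finset.univ.filter fun x => x.win w ∉ A

theorem mem_windowAttack {w : ℕ} {A : Finset ℕ} {x : PathMetric n} :
    x ∈ windowAttack n w A ↔ x.win w ∉ A := by simp [windowAttack]

theorem sum_subsetWeight_card_windowAttack (n w : ℕ) (q : ℝ) :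
    ∑ A ∈ (Finset.range n).powerset, subsetWeight (Finset.range n) q A *
      (windowAttack n w A).card = (1 - q) * n := by
  have h1 : ∑ A ∈ (Finset.range n).powerset, subsetWeight (Finset.range n) q A = 1 := by
    simpa using sum_subsetWeight (Finset.range n) ∅ (by simp) q
  calc _ = ∑ A ∈ (Finset.range n).powerset, ∑ x : PathMetric n,
        (subsetWeight (Finset.range n) q A -
        subsetWeight (Finset.range n) q A * (if {x.win w} ⊆ A then 1 else 0)) := by
        refine Finset.sum_congr rfl fun A _ => ?_
        unfold windowAttack
        rw [← Finset.sum_boole, Finset.mul_sum]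
        refine Finset.sum_congr rfl fun x _ => ?_
        by_cases h : x.win w ∈ A <;> simp [h]
    _ = ∑ x : PathMetric n, (1 - q) := by
        rw [Finset.sum_comm]
        refine Finset.sum_congr rfl fun x _ => ?_
        rw [Finset.sum_sub_distrib, h1, sum_subsetWeight _ _ (by simpa using x.win_mem_range w)]
        simp
    _ = _ := by
        rw [Finset.sum_const, nsmul_eq_mul, Finset.card_univ, card_eq]; ring

theorem exists_adj_of_walk (G : SimpleGraph (PathMetric n)) (w : ℕ) (s : Set (PathMetric n))
    {x y : s} (p : (G.induce s).Walk x y) (h : y.1.win w ≠ x.1.win w) :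
    ∃ a b, G.Adj a b ∧ a.win w = x.1.win w ∧ b.win w ≠ x.1.win w ∧ b ∈ s := by
  induction p with
  | nil => exact absurd rfl h
  | @cons u v z hadj p ih =>
    by_cases hv : v.1.win w = u.1.win w
    · rw [← hv] at h ⊢
      exact ih h
    · exact ⟨u, v, hadj, rfl, hv, v.2⟩

-- Either all vertices outside `Bp` lie in one window, and there are at most `w` of them, or each is
-- connected to one in another window. In the second case the walk leaves the window along an edge
-- whose far end is again unattacked, hence in a surviving window.
open Classical in
theorem le_card_add_card_touches (G : SimpleGraph (PathMetric n)) {w : ℕ} (hw : 1 ≤ w)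
    (A : Finset ℕ) (Bp : Finset (PathMetric n)) (hB : windowAttack n w A ⊆ Bp)
    (hconn : ∀ x y : {z : PathMetric n | z ∉ windowAttack n w A}, x.1 ∉ Bp → y.1 ∉ Bp →
      Nonempty ((G.induce {z : PathMetric n | z ∉ windowAttack n w A}).Walk x y)) :
    n ≤ Bp.card + (Finset.univ.filter (Touches G w A)).card + w := by
  have hcompl : Bp.card + Bpᶜ.card = n := by rw [Finset.card_add_card_compl, card_eq]
  suffices Bpᶜ.card ≤ (Finset.univ.filter (Touches G w A)).card + w by omega
  by_cases h : ∃ i, ∀ x ∈ Bpᶜ, x.win w = i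
  · obtain ⟨i, hi⟩ := h
    have : Bpᶜ ⊆ Finset.univ.filter fun x : PathMetric n => x.win w = i := fun x hx => by
      simpa using hi x hx
    have := (Finset.card_le_card this).trans (card_win_eq_le hw i)
    omega
  · push Not at h
    refine le_add_right (Finset.card_le_card fun x hx => ?_)
    obtain ⟨y, hy, hne⟩ := h (x.win w)
    rw [Finset.mem_compl] at hx hy
    obtain ⟨p⟩ := hconn ⟨x, fun h => hx (hB h)⟩ ⟨y, fun h => hy (hB h)⟩ hx hy
    obtain ⟨a, b, hab, ha, hb, hbs⟩ := exists_adj_of_walk G w _ p hne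
    have hxA : x.win w ∈ A := by
      by_contra hxA
      exact hx (hB (mem_windowAttack.2 hxA))
    refine Finset.mem_filter.2 ⟨Finset.mem_univ _, hxA, a, b, hab, ha, hb, ?_⟩
    by_contra hbA
    exact hbs (mem_windowAttack.2 hbA)

/-- A reliable spanner of the path has many long edges at all prescribed scales at once. -/
theorem exists_le_sum_card_farPairs {ν t q : ℝ} (hν : 0 ≤ ν) (h0 : 0 ≤ q) (h1 : q ≤ 1)
    (D : PMF (WeightedGraph (PathMetric n))) (hD : IsObliviousReliableSpanner D ν t)
    (k : ℕ) (J : Finset ℕ) (w : ℕ → ℕ) (hw : ∀ j, 1 ≤ w j) :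
    ∃ H ∈ D.support, ∑ j ∈ J, ((q - ν) * n - w j - 2 * k * n * q ^ 2) ≤
      2 * q ^ 2 * ∑ j ∈ J, (w j * (farPairs H.graph (w j) k).card : ℝ) := by
  classical
  choose Bp hBp hE using hD.2
  set I := Finset.range n with hI
  -- The average runs over scales `j` and surviving sets `A` jointly, with the probability of `A` as
  -- weight, so that one `H` serves all scales.
  obtain ⟨H, hH, hsum⟩ := exists_mem_support_sum_le D (J ×ˢ I.powerset)
    (fun p => subsetWeight I q p.2) (fun p => (1 + ν) * (windowAttack n (w p.1) p.2).card)
    (fun p _ => subsetWeight_nonneg _ h0 h1 _) (fun p _ => by positivity)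
    (fun p H => (Bp (windowAttack n (w p.1) p.2) H).card) (fun p _ => hE _)
  refine ⟨H, hH, ?_⟩
  rw [Finset.sum_product, Finset.sum_product, ← sub_nonneg, ← Finset.sum_sub_distrib] at hsum
  rw [Finset.mul_sum, ← sub_nonneg, ← Finset.sum_sub_distrib]
  refine hsum.trans (Finset.sum_le_sum fun j _ => ?_)
  have hone : ∑ A ∈ I.powerset, subsetWeight I q A = 1 := by
    simpa using sum_subsetWeight I ∅ (by simp) q
  have hA : ∀ A ∈ I.powerset, subsetWeight I q A * n ≤
      subsetWeight I q A * (Bp (windowAttack n (w j) A) H).card +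
      subsetWeight I q A * (Finset.univ.filter (Touches H.graph (w j) A)).card +
      subsetWeight I q A * w j := by
    intro A _
    rw [← mul_add, ← mul_add]
    refine mul_le_mul_of_nonneg_left ?_ (subsetWeight_nonneg _ h0 h1 _)
    have := le_card_add_card_touches H.graph (hw j) A (Bp (windowAttack n (w j) A) H)
      (hBp _ H hH).1 fun x y hx hy =>
        WeightedGraph.exists_walk_of_pathDist_lt_top (H.induce _)
          (((hBp _ H hH).2 x y hx hy).trans_lt ENNReal.ofReal_lt_top)
    exact_mod_cast this
  have hA' := Finset.sum_le_sum hA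
  rw [Finset.sum_add_distrib, Finset.sum_add_distrib, ← Finset.sum_mul, ← Finset.sum_mul, hone]
    at hA'
  have ht := sum_subsetWeight_card_touches_le H.graph (hw j) k h0 h1
  have hatt := sum_subsetWeight_card_windowAttack n (w j) q
  have hatt' : ∑ A ∈ I.powerset, subsetWeight I q A *
      ((1 + ν) * (windowAttack n (w j) A).card) = (1 + ν) * ((1 - q) * n) := by
    rw [← hatt, Finset.mul_sum]
    exact Finset.sum_congr rfl fun A _ => by ring
  rw [hatt']
  -- Since `1 - (1 + ν) * (1 - q) = q - ν + ν * q`, dropping the last term leaves the survivors `(q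
  -- - ν) * n`.
  have : 0 ≤ ν * q * n := by positivity
  simp only at *
  nlinarith

/-! ### Long edges against total weight -/

/-- Summed over dyadic scales, long edges are paid for by the weight. -/
theorem sum_dyadic_le (lam : ℝ) (hlam : 0 ≤ lam) (k : ℝ) (hk : 0 ≤ k) (r : ℕ) :
    ∑ j ∈ Finset.range r, (if k * 2 ^ j ≤ lam then k * 2 ^ j else 0) ≤ 2 * lam := by
  -- The second bound is needed for the induction: a new term `k * 2 ^ r ≤ lam` is joined by a
  -- previous sum of at most `k * 2 ^ r`.
  suffices h : ∑ j ∈ Finset.range r, (if k * 2 ^ j ≤ lam then k * 2 ^ j else 0) ≤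
      min (2 * lam) (k * 2 ^ r) from h.trans (min_le_left _ _)
  induction r with
  | zero => simp; exact ⟨hlam, hk⟩
  | succ r ih =>
    rw [Finset.sum_range_succ, pow_succ]
    have h1 := ih.trans (min_le_left _ _)
    have h2 := ih.trans (min_le_right _ _)
    have : 0 ≤ k * 2 ^ r := by positivity
    split_ifs with h
    · refine le_min ?_ ?_ <;> linarith
    · refine le_min ?_ ?_ <;> linarith

theorem sum_farPairs_le_totalWeight {H : WeightedGraph (PathMetric n)} (hH : H.Dominates)
    (S : Finset (PathMetric n × PathMetric n))
    (hS : ∀ p ∈ S, H.graph.Adj p.1 p.2 ∧ p.1.pos < p.2.pos) :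
    ∑ p ∈ S, dist p.1 p.2 ≤ H.totalWeight := by
  classical
  rw [H.totalWeight_eq_sum]
  have hinj : Set.InjOn (fun p : PathMetric n × PathMetric n => s(p.1, p.2)) S := by
    rintro ⟨a, b⟩ hp ⟨c, d⟩ hq h
    have h1 := (hS _ hp).2
    have h2 := (hS _ hq).2
    rcases Sym2.eq_iff.1 h with ⟨rfl, rfl⟩ | ⟨rfl, rfl⟩
    · rfl
    · dsimp only at h1 h2; omega
  calc _ ≤ ∑ p ∈ S, (H.weight s(p.1, p.2) : ℝ) :=
        Finset.sum_le_sum fun p hp => hH.dist_le_weight (hS p hp).1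
    _ = ∑ e ∈ S.image (fun p => s(p.1, p.2)), (H.weight e : ℝ) :=
        (Finset.sum_image (f := fun e => (H.weight e : ℝ)) hinj).symm
    _ ≤ _ := by
        refine Finset.sum_le_sum_of_subset_of_nonneg ?_ fun _ _ _ => NNReal.coe_nonneg _
        intro e he
        obtain ⟨p, hp, rfl⟩ := Finset.mem_image.1 he
        rw [Set.Finite.mem_toFinset]
        exact (hS p hp).1

/-- At least `k` full windows lie strictly between the windows of `x` and `y`. -/
theorem lt_pos_of_win_lt {w k : ℕ} {x y : PathMetric n} (h : x.win w + k < y.win w) :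
    x.pos + k * w < y.pos := by
  unfold win at h
  have hw : 0 < w := by
    rcases Nat.eq_zero_or_pos w with rfl | h'
    · simp at h
    · exact h'
  have h1 : (x.pos / w + k + 1) * w ≤ y.pos :=
    (Nat.mul_le_mul_right w h).trans (Nat.div_mul_le_self _ _)
  have h2 := Nat.lt_div_mul_add (a := x.pos) hw
  nlinarith

theorem dist_of_mem_farPairs {G : SimpleGraph (PathMetric n)} {w k : ℕ}
    {p : PathMetric n × PathMetric n} (hp : p ∈ farPairs G w k) :
    p.1.pos < p.2.pos ∧ (k * w + 1 : ℝ) ≤ dist p.1 p.2 := by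
  have h := lt_pos_of_win_lt (mem_farPairs.1 hp).2
  refine ⟨by omega, ?_⟩
  rw [dist_comm, dist_eq]
  refine le_trans ?_ (le_abs_self _)
  have : ((p.1.pos + k * w + 1 : ℕ) : ℝ) ≤ (p.2.pos : ℕ) := by exact_mod_cast h
  push_cast at this
  linarith

/-- Each edge pays `k * 2 ^ j` at every scale where it is far. This happens only while `k * 2 ^ j`
is at most its length, so it pays at most twice its length, and by dominance its weight is at least
its length. -/
theorem sum_dyadic_card_farPairs_le {H : WeightedGraph (PathMetric n)} (hH : H.Dominates)
    (k r : ℕ) :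
    ∑ j ∈ Finset.range r, (k * 2 ^ j * (farPairs H.graph (2 ^ j) k).card : ℝ) ≤
      2 * H.totalWeight := by
  classical
  set S : Finset (PathMetric n × PathMetric n) :=
    Finset.univ.filter fun p => H.graph.Adj p.1 p.2 ∧ p.1.pos < p.2.pos with hS
  have hbound : ∀ j ∈ Finset.range r, (k * 2 ^ j * (farPairs H.graph (2 ^ j) k).card : ℝ) ≤
      ∑ p ∈ S, (if (k : ℝ) * 2 ^ j ≤ dist p.1 p.2 then (k : ℝ) * 2 ^ j else 0) := by
    intro j _
    rw [← Finset.sum_filter, Finset.sum_const, nsmul_eq_mul, mul_comm]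
    refine mul_le_mul_of_nonneg_right ?_ (by positivity)
    have : farPairs H.graph (2 ^ j) k ⊆ S.filter fun p => (k : ℝ) * 2 ^ j ≤ dist p.1 p.2 := by
      intro p hp
      have h := dist_of_mem_farPairs hp
      push_cast at h
      rw [Finset.mem_filter, hS, Finset.mem_filter]
      exact ⟨⟨Finset.mem_univ _, (mem_farPairs.1 hp).1, h.1⟩, by linarith [h.2]⟩
    exact_mod_cast Finset.card_le_card this
  calc _ ≤ _ := Finset.sum_le_sum hbound
    _ = ∑ p ∈ S, ∑ j ∈ Finset.range r,
        (if (k : ℝ) * 2 ^ j ≤ dist p.1 p.2 then (k : ℝ) * 2 ^ j else 0) := Finset.sum_comm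
    _ ≤ ∑ p ∈ S, 2 * dist p.1 p.2 :=
        Finset.sum_le_sum fun p _ => sum_dyadic_le _ dist_nonneg _ (Nat.cast_nonneg _) _
    _ = 2 * ∑ p ∈ S, dist p.1 p.2 := by rw [Finset.mul_sum]
    _ ≤ _ := by
        refine mul_le_mul_of_nonneg_left ?_ (by norm_num)
        exact sum_farPairs_le_totalWeight hH S fun p hp => (Finset.mem_filter.1 hp).2

theorem totalWeight_le_of_lightness (hn : 2 ≤ n) {H : WeightedGraph (PathMetric n)} {φ : ℝ}
    (h : H.lightness ≤ φ) : H.totalWeight ≤ φ * n := by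
  have hpos := mstWeight_pos (PathMetric n) (by rw [card_eq]; exact hn)
  have hφ : 0 ≤ φ := le_trans (div_nonneg H.totalWeight_nonneg hpos.le) h
  rw [WeightedGraph.lightness, div_le_iff₀ hpos] at h
  exact h.trans (mul_le_mul_of_nonneg_left (mstWeight_le (by omega)) hφ)

/-! ### The lower bound on the lightness -/

/-- With `q = 4ν` and `k ≤ 1 / (16ν)`, the term `3νn` of required survivors loses at most `2νn` to
near windows and `νn / 2` to the window length, which leaves `νn / 2` at each of the `⌊log (νn)⌋`
scales. As `νn ≥ 4`, rounding the logarithm down costs at most a factor two. -/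
theorem le_lightness_of_four_le {ν t φ : ℝ} (hν : 0 < ν) (hν' : ν < 1 / 16) (hn : 2 ≤ n)
    (hνn : 4 ≤ ν * n) (D : PMF (WeightedGraph (PathMetric n)))
    (hD : IsObliviousReliableSpanner D ν t) (hφ : HasLightnessAtMost D φ) :
    1 / 8192 * (ν⁻¹ ^ 2 * Real.logb 2 (ν * n)) ≤ φ := by
  set y := ν * n with hy
  have hlog : 2 ≤ Real.logb 2 y := by
    rw [Real.le_logb_iff_rpow_le (by norm_num) (by linarith)]; norm_num; exact hνn
  set r := ⌊Real.logb 2 y⌋₊ with hr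
  have hr1 : (r : ℝ) ≤ Real.logb 2 y := Nat.floor_le (by linarith)
  have hr2 : Real.logb 2 y < r + 1 := Nat.lt_floor_add_one _
  set k := ⌊1 / (16 * ν)⌋₊ with hk
  have hk0 : (1 : ℝ) < 1 / (16 * ν) := by rw [lt_div_iff₀ (by positivity)]; linarith
  have hk1 : (k : ℝ) ≤ 1 / (16 * ν) := Nat.floor_le (by positivity)
  have hk2 : 1 / (16 * ν) < k + 1 := Nat.lt_floor_add_one _
  have hk3 : (1 : ℝ) ≤ k := by
    have : 1 ≤ k := Nat.le_floor (by simpa using hk0.le)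
    exact_mod_cast this
  have hk4 : 1 / (32 * ν) ≤ k := by
    have : 1 / (32 * ν) = 1 / (16 * ν) / 2 := by field_simp; norm_num
    rw [this]; linarith
  obtain ⟨H, hH, h⟩ := exists_le_sum_card_farPairs (q := 4 * ν) hν.le (by linarith)
    (by linarith) D hD k (Finset.range r) (fun j => 2 ^ j) (fun j => Nat.one_le_two_pow)
  have hdy := sum_dyadic_card_farPairs_le (hD.1 H hH) k r
  have hw := totalWeight_le_of_lightness hn (hφ H hH)
  have hkν : k * ν ≤ 1 / 16 := by
    calc k * ν ≤ 1 / (16 * ν) * ν := mul_le_mul_of_nonneg_right hk1 hν.le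
      _ = 1 / 16 := by field_simp
  have hscale : ∀ j ∈ Finset.range r, y / 2 ≤
      (4 * ν - ν) * n - ((2 ^ j : ℕ) : ℝ) - 2 * k * n * (4 * ν) ^ 2 := by
    intro j hj
    have hj1 : (2 : ℝ) ^ j ≤ y / 2 := by
      have hj' : (j : ℝ) + 1 ≤ Real.logb 2 y := by
        refine le_trans ?_ hr1
        exact_mod_cast Finset.mem_range.1 hj
      rw [Real.le_logb_iff_rpow_le (by norm_num) (by linarith)] at hj'
      have e : (2 : ℝ) ^ ((j : ℝ) + 1) = 2 ^ j * 2 := by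
        rw [Real.rpow_add_one (by norm_num), Real.rpow_natCast]
      rw [e] at hj'
      linarith
    have h2 : 2 * k * n * (4 * ν) ^ 2 ≤ 2 * y := by
      have : 2 * k * n * (4 * ν) ^ 2 = 32 * (k * ν) * y := by rw [hy]; ring
      rw [this]
      nlinarith
    have h3 : (4 * ν - ν) * n = 3 * y := by rw [hy]; ring
    rw [h3]; push_cast; linarith
  have hlow := Finset.sum_le_sum hscale
  rw [Finset.sum_const, Finset.card_range, nsmul_eq_mul] at hlow
  have hdy' : (k : ℝ) * ∑ j ∈ Finset.range r,
      (((2 ^ j : ℕ) : ℝ) * (farPairs H.graph (2 ^ j) k).card) ≤ 2 * (φ * n) := by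
    rw [Finset.mul_sum]
    refine le_trans (le_of_eq (Finset.sum_congr rfl fun j _ => ?_)) (hdy.trans (by linarith))
    push_cast; ring
  set S := ∑ j ∈ Finset.range r,
      (((2 ^ j : ℕ) : ℝ) * (farPairs H.graph (2 ^ j) k).card) with hSum
  have hmain := hlow.trans h
  have hSum0 : 0 ≤ S := Finset.sum_nonneg fun _ _ => by positivity
  have hnpos : (0 : ℝ) < n := by exact_mod_cast (by omega : 0 < n)
  have h5 : 1 / (32 * ν) * S ≤ 2 * (φ * n) :=
    (mul_le_mul_of_nonneg_right hk4 hSum0).trans hdy'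
  have h6 : S ≤ 64 * ν * (φ * n) := by
    have : 1 / (32 * ν) * S = S / (32 * ν) := by ring
    rw [this, div_le_iff₀ (by positivity)] at h5
    linarith
  have h7 : r * (ν * n / 2) ≤ 2 * (4 * ν) ^ 2 * (64 * ν * (φ * n)) :=
    hmain.trans (mul_le_mul_of_nonneg_left h6 (by positivity))
  have h8 : r ≤ 4096 * ν ^ 2 * φ := by
    have hpos : 0 < ν * n / 2 := by positivity
    refine le_of_mul_le_mul_right (h7.trans (le_of_eq ?_)) hpos
    ring
  have h9 : Real.logb 2 y ≤ 8192 * ν ^ 2 * φ := by linarith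
  calc 1 / 8192 * (ν⁻¹ ^ 2 * Real.logb 2 y) ≤ 1 / 8192 * (ν⁻¹ ^ 2 * (8192 * ν ^ 2 * φ)) := by
        gcongr
    _ = φ := by field_simp

/-- Here the logarithm is below two and a single scale suffices: windows are single vertices and `q
= 8ν`, so `7νn` loses `1 < νn` and at most `4νn`. As `k` may be zero, the edge length is bounded
below by `k + 1`, which exceeds `1 / (32ν)`. -/
theorem le_lightness_of_lt_four {ν t φ : ℝ} (hν : 0 < ν) (hν' : ν < 1 / 16) (hn : 2 ≤ n)
    (hνn : 1 < ν * n) (hνn' : ν * n < 4) (D : PMF (WeightedGraph (PathMetric n)))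
    (hD : IsObliviousReliableSpanner D ν t) (hφ : HasLightnessAtMost D φ) :
    1 / 8192 * (ν⁻¹ ^ 2 * Real.logb 2 (ν * n)) ≤ φ := by
  set y := ν * n with hy
  have hlog : Real.logb 2 y ≤ 2 := by
    rw [Real.logb_le_iff_le_rpow (by norm_num) (by linarith)]; norm_num; exact hνn'.le
  set k := ⌊1 / (32 * ν)⌋₊ with hk
  have hk1 : (k : ℝ) ≤ 1 / (32 * ν) := Nat.floor_le (by positivity)
  have hk2 : 1 / (32 * ν) < k + 1 := Nat.lt_floor_add_one _
  obtain ⟨H, hH, h⟩ := exists_le_sum_card_farPairs (q := 8 * ν) hν.le (by linarith)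
    (by linarith) D hD k {0} (fun _ => 1) (fun _ => le_rfl)
  have hw := totalWeight_le_of_lightness hn (hφ H hH)
  have hfar : ((farPairs H.graph 1 k).card : ℝ) * (k + 1) ≤ H.totalWeight := by
    rw [← nsmul_eq_mul, ← Finset.sum_const]
    refine (Finset.sum_le_sum fun p hp => ?_).trans
      (sum_farPairs_le_totalWeight (hD.1 H hH) (farPairs H.graph 1 k) fun p hp =>
        ⟨(mem_farPairs.1 hp).1, (dist_of_mem_farPairs hp).1⟩)
    simpa using (dist_of_mem_farPairs hp).2
  simp only [Finset.sum_singleton, Nat.cast_one, one_mul] at h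
  set F := ((farPairs H.graph 1 k).card : ℝ) with hF
  have hF0 : 0 ≤ F := Nat.cast_nonneg _
  have hkν : k * ν ≤ 1 / 32 := by
    calc k * ν ≤ 1 / (32 * ν) * ν := mul_le_mul_of_nonneg_right hk1 hν.le
      _ = 1 / 32 := by field_simp
  have h2 : 2 * k * n * (8 * ν) ^ 2 ≤ 4 * y := by
    have : 2 * k * n * (8 * ν) ^ 2 = 128 * (k * ν) * y := by rw [hy]; ring
    rw [this]
    nlinarith
  have h3 : (8 * ν - ν) * n = 7 * y := by rw [hy]; ring
  have h4 : 2 * y ≤ 2 * (8 * ν) ^ 2 * F := by linarith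
  have hnpos : (0 : ℝ) < n := by exact_mod_cast (by omega : 0 < n)
  have h5 : F * (1 / (32 * ν)) ≤ φ * n :=
    (mul_le_mul_of_nonneg_left hk2.le hF0).trans (hfar.trans hw)
  have h6 : F ≤ 32 * ν * (φ * n) := by
    have : F * (1 / (32 * ν)) = F / (32 * ν) := by ring
    rw [this, div_le_iff₀ (by positivity)] at h5
    linarith
  have h7 : 2 * (ν * n) ≤ 2 * (8 * ν) ^ 2 * (32 * ν * (φ * n)) :=
    h4.trans (mul_le_mul_of_nonneg_left h6 (by positivity))
  have h8 : 1 ≤ 2048 * ν ^ 2 * φ := by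
    have hpos : 0 < 2 * (ν * n) := by positivity
    refine le_of_mul_le_mul_right (le_trans (by linarith) (h7.trans (le_of_eq ?_))) hpos
    ring
  have h9 : Real.logb 2 y ≤ 8192 * ν ^ 2 * φ := by linarith
  calc 1 / 8192 * (ν⁻¹ ^ 2 * Real.logb 2 y) ≤ 1 / 8192 * (ν⁻¹ ^ 2 * (8192 * ν ^ 2 * φ)) := by
        gcongr
    _ = φ := by field_simp

theorem le_lightness {ν t φ : ℝ} (hν : 0 < ν) (hν' : ν < 1 / 16) (hn : 2 ≤ n)
    (D : PMF (WeightedGraph (PathMetric n)))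
    (hD : IsObliviousReliableSpanner D ν t) (hφ : HasLightnessAtMost D φ) :
    1 / 8192 * (ν⁻¹ ^ 2 * Real.logb 2 (ν * n)) ≤ φ := by
  rcases le_or_gt (ν * n) 1 with h | h
  · obtain ⟨H, hH⟩ := D.support_nonempty
    have hpos := mstWeight_pos (PathMetric n) (by rw [card_eq]; exact hn)
    have h0 : 0 ≤ φ := le_trans (div_nonneg H.totalWeight_nonneg hpos.le) (hφ H hH)
    refine le_trans ?_ h0
    have : Real.logb 2 (ν * n) ≤ 0 := Real.logb_nonpos (by norm_num) (by positivity) h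
    have h2 : 0 ≤ ν⁻¹ ^ 2 := by positivity
    nlinarith
  · rcases le_or_gt 4 (ν * n) with h' | h'
    · exact le_lightness_of_four_le hν hν' hn h' D hD hφ
    · exact le_lightness_of_lt_four hν hν' hn h h' D hD hφ

end PathMetric

/-! ### Net trees and their clusters -/

/-- A hierarchy of nested nets with scales `δ * 2 ^ i`, given by the maps `anc i` that send a
point to its ancestor in the `i`-th net. -/
structure NetTree (X : Type*) [MetricSpace X] (δ : ℝ) where
  anc : ℕ → X → X
  anc_zero : ∀ x, anc 0 x = x
  anc_anc : ∀ i x, anc i (anc i x) = anc i x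
  anc_succ_anc : ∀ i x, anc (i + 1) (anc i x) = anc (i + 1) x
  anc_anc_succ : ∀ i x, anc i (anc (i + 1) x) = anc (i + 1) x
  lt_dist : ∀ i x y, anc i x ≠ anc i y → δ * 2 ^ i < dist (anc i x) (anc i y)
  dist_succ_le : ∀ i x, dist (anc i x) (anc (i + 1) x) ≤ δ * 2 ^ (i + 1)

/-- Take a separated subset of `N` of maximal cardinality. By maximality each point of `N` is within
`r` of it, and the retraction fixes its points. -/
theorem exists_separated_retraction {X : Type*} [MetricSpace X] [Fintype X] (N : Finset X)
    (r : ℝ) (hr : 0 ≤ r) :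
    ∃ φ : X → X, (∀ x ∈ N, φ x ∈ N ∧ dist x (φ x) ≤ r ∧ φ (φ x) = φ x) ∧
      ∀ x ∈ N, ∀ y ∈ N, φ x ≠ φ y → r < dist (φ x) (φ y) := by
  classical
  set P : Finset (Finset X) := N.powerset.filter fun S => ∀ p ∈ S, ∀ q ∈ S, p ≠ q → r < dist p q
  obtain ⟨S, hS, hmax⟩ := P.exists_max_image Finset.card ⟨∅, by simp [P]⟩
  obtain ⟨hSN, hsep⟩ := Finset.mem_filter.1 hS
  rw [Finset.mem_powerset] at hSN
  have hcov : ∀ x, ∃ p, x ∈ N → p ∈ S ∧ dist x p ≤ r ∧ (x ∈ S → p = x) := by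
    intro x
    by_cases hxS : x ∈ S
    · exact ⟨x, fun _ => ⟨hxS, by simpa using hr, fun _ => rfl⟩⟩
    by_contra! hcon
    have hx : ∀ p ∈ S, r < dist x p := fun p hp => by
      by_contra! hle
      exact hxS ((hcon p).2 hp hle).1
    have hxN := (hcon x).1
    have : insert x S ∈ P := by
      refine Finset.mem_filter.2 ⟨Finset.mem_powerset.2 (Finset.insert_subset hxN hSN), ?_⟩
      intro p hp q hq hne
      rcases Finset.mem_insert.1 hp with rfl | hpS <;> rcases Finset.mem_insert.1 hq with rfl | hqS
      · exact absurd rfl hne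
      · exact hx q hqS
      · rw [dist_comm]; exact hx p hpS
      · exact hsep p hpS q hqS hne
    have := hmax _ this
    rw [Finset.card_insert_of_notMem hxS] at this
    omega
  choose φ hφ using hcov
  refine ⟨φ, fun x hx => ?_, fun x hx y hy hne => hsep _ (hφ x hx).1 _ (hφ y hy).1 hne⟩
  have h := hφ x hx
  exact ⟨hSN h.1, h.2.1, (hφ _ (hSN h.1)).2.2 h.1⟩

theorem exists_coarser_ancestor {X : Type*} [MetricSpace X] [Fintype X] (f : X → X)
    (hf : ∀ x, f (f x) = f x) (r : ℝ) (hr : 0 ≤ r) :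
    ∃ g : X → X, (∀ x, g (g x) = g x) ∧ (∀ x, g (f x) = g x) ∧ (∀ x, f (g x) = g x) ∧
      (∀ x y, g x ≠ g y → r < dist (g x) (g y)) ∧ ∀ x, dist (f x) (g x) ≤ r := by
  classical
  obtain ⟨φ, h1, h2⟩ := exists_separated_retraction (Finset.univ.image f) r hr
  have hm : ∀ x, f x ∈ Finset.univ.image f := fun x =>
    Finset.mem_image_of_mem _ (Finset.mem_univ _)
  have hfφ : ∀ x, f (φ (f x)) = φ (f x) := fun x => by
    obtain ⟨z, -, hz⟩ := Finset.mem_image.1 (h1 _ (hm x)).1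
    rw [← hz, hf]
  exact ⟨fun x => φ (f x), fun x => by
    dsimp only; rw [hfφ, (h1 _ (hm x)).2.2], fun x => by dsimp only; rw [hf], hfφ,
    fun x y => h2 _ (hm x) _ (hm y), fun x => (h1 _ (hm x)).2.1⟩

theorem NetTree.exists {X : Type*} [MetricSpace X] [Fintype X] {δ : ℝ} (hδ : 0 < δ)
    (hsep : ∀ x y : X, x ≠ y → δ < dist x y) : Nonempty (NetTree X δ) := by
  have step : ∀ (i : ℕ) (f : {f : X → X // ∀ x, f (f x) = f x}),
      ∃ g : {f : X → X // ∀ x, f (f x) = f x}, (∀ x, g.1 (f.1 x) = g.1 x) ∧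
        (∀ x, f.1 (g.1 x) = g.1 x) ∧
        (∀ x y, g.1 x ≠ g.1 y → δ * 2 ^ (i + 1) < dist (g.1 x) (g.1 y)) ∧
        ∀ x, dist (f.1 x) (g.1 x) ≤ δ * 2 ^ (i + 1) := by
    intro i f
    obtain ⟨g, hg, h⟩ := exists_coarser_ancestor f.1 f.2 (δ * 2 ^ (i + 1)) (by positivity)
    exact ⟨⟨g, hg⟩, h⟩
  choose G hG using step
  let F : ℕ → {f : X → X // ∀ x, f (f x) = f x} :=
    fun i => Nat.rec ⟨id, fun _ => rfl⟩ (fun i f => G i f) i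
  have hF : ∀ i, F (i + 1) = G i (F i) := fun i => rfl
  refine ⟨⟨fun i => (F i).1, fun x => rfl, fun i => (F i).2, ?_, ?_, ?_, ?_⟩⟩
  · intro i x; rw [hF]; exact (hG i (F i)).1 x
  · intro i x; rw [hF]; exact (hG i (F i)).2.1 x
  · intro i x y hne
    cases i with
    -- Level zero is the identity, so its separation is the assumption that `δ` lies below all
    -- distances.
    | zero => rw [pow_zero, mul_one]; exact hsep x y hne
    | succ i => rw [hF] at hne ⊢; exact (hG i (F i)).2.2.1 x y hne
  · intro i x; rw [hF]; exact (hG i (F i)).2.2.2 x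

namespace NetTree

variable {X : Type*} [MetricSpace X] {δ : ℝ} (T : NetTree X δ)

theorem anc_eq_of_le {i j : ℕ} (hij : i ≤ j) {x y : X} (h : T.anc i x = T.anc i y) :
    T.anc j x = T.anc j y := by
  induction j, hij using Nat.le_induction with
  | base => exact h
  | succ j _ ih => rw [← T.anc_succ_anc, ih, T.anc_succ_anc]

theorem anc_anc_of_le {i j : ℕ} (hij : i ≤ j) (x : X) : T.anc i (T.anc j x) = T.anc j x := by
  induction j, hij using Nat.le_induction generalizing x with
  | base => exact T.anc_anc i x
  | succ j _ ih => rw [← T.anc_anc_succ j x, ih]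

theorem dist_anc_le (hδ : 0 ≤ δ) (i : ℕ) (x : X) : dist x (T.anc i x) ≤ 2 * (δ * 2 ^ i) := by
  -- The steps `δ * 2 ^ (j + 1)` for `j < i` add up to exactly this value.
  have : dist x (T.anc i x) ≤ 2 * (δ * 2 ^ i) - 2 * δ := by
    induction i with
    | zero => simp [T.anc_zero]
    | succ i ih =>
      have := T.dist_succ_le i x
      have t := dist_triangle x (T.anc i x) (T.anc (i + 1) x)
      rw [pow_succ] at *
      linarith
  linarith

variable [Fintype X]

open Classical in
/-- The `i`-th net. -/
noncomputable def net (i : ℕ) : Finset X := Finset.univ.image (T.anc i)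

theorem mem_net {i : ℕ} {p : X} : p ∈ T.net i ↔ T.anc i p = p := by
  simp only [net, Finset.mem_image, Finset.mem_univ, true_and]
  exact ⟨fun ⟨x, hx⟩ => by rw [← hx, T.anc_anc], fun h => ⟨p, h⟩⟩

theorem anc_mem_net (i : ℕ) (x : X) : T.anc i x ∈ T.net i := T.mem_net.2 (T.anc_anc i x)

theorem net_antitone : Antitone T.net := fun i j hij p hp => by
  rw [mem_net] at hp ⊢
  rw [← hp, T.anc_anc_of_le hij]

theorem net_sep {i : ℕ} {p q : X} (hp : p ∈ T.net i) (hq : q ∈ T.net i) (h : p ≠ q) :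
    δ * 2 ^ i < dist p q := by
  rw [mem_net] at hp hq
  have := T.lt_dist i p q (by rwa [hp, hq])
  rwa [hp, hq] at this

open Classical in
/-- The points with the same `i`-th ancestor as `x`. -/
noncomputable def cluster (i : ℕ) (x : X) : Finset X :=
  Finset.univ.filter fun y => T.anc i y = T.anc i x

theorem mem_cluster {i : ℕ} {x y : X} : y ∈ T.cluster i x ↔ T.anc i y = T.anc i x := by
  simp [cluster]

theorem self_mem_cluster (i : ℕ) (x : X) : x ∈ T.cluster i x := T.mem_cluster.2 rfl

theorem cluster_eq_iff {i : ℕ} {x y : X} :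
    T.cluster i x = T.cluster i y ↔ T.anc i x = T.anc i y := by
  refine ⟨fun h => ?_, fun h => ?_⟩
  · have := T.self_mem_cluster i x
    rw [h] at this
    exact T.mem_cluster.1 this
  · unfold cluster; rw [h]

theorem cluster_eq_of_mem {i : ℕ} {x y : X} (h : y ∈ T.cluster i x) :
    T.cluster i y = T.cluster i x := T.cluster_eq_iff.2 (T.mem_cluster.1 h)

theorem cluster_zero (x : X) : T.cluster 0 x = {x} := by
  ext y; simp [mem_cluster, T.anc_zero]

theorem cluster_subset {i j : ℕ} (hij : i ≤ j) (x : X) : T.cluster i x ⊆ T.cluster j x :=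
  fun _ hy => T.mem_cluster.2 (T.anc_eq_of_le hij (T.mem_cluster.1 hy))

theorem cluster_subset_of_mem {i j : ℕ} (hij : i ≤ j) {x y z : X} (hx : z ∈ T.cluster i x)
    (hy : z ∈ T.cluster j y) : T.cluster i x ⊆ T.cluster j y := by
  rw [← T.cluster_eq_of_mem hx, ← T.cluster_eq_of_mem hy]
  exact T.cluster_subset hij z

theorem dist_le_of_mem_cluster (hδ : 0 ≤ δ) {i : ℕ} {x y z : X} (hy : y ∈ T.cluster i x)
    (hz : z ∈ T.cluster i x) : dist y z ≤ 4 * (δ * 2 ^ i) := by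
  have h1 := T.dist_anc_le hδ i y
  have h2 := T.dist_anc_le hδ i z
  rw [T.mem_cluster.1 hy] at h1
  rw [T.mem_cluster.1 hz] at h2
  have := dist_triangle_right y z (T.anc i x)
  linarith

end NetTree

/-! ### Packing bounds from the doubling dimension -/

theorem HasDoublingDimension.exists_cover {X : Type*} [MetricSpace X] {ddim : ℝ}
    (h : HasDoublingDimension X ddim) (m : ℕ) {r : ℝ} (hr : 0 < r) (x : X) :
    ∃ S : Finset X, (S.card : ℝ) ≤ ((2 : ℝ) ^ ddim) ^ m ∧
      Metric.closedBall x (2 ^ m * r) ⊆ ⋃ c ∈ S, Metric.closedBall c r := by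
  classical
  induction m generalizing x with
  | zero => exact ⟨{x}, by simp, by simp⟩
  | succ m ih =>
    obtain ⟨S, hS, hcov⟩ := h (2 ^ m * r) (by positivity) x
    choose F hF hFc using ih
    refine ⟨S.biUnion F, ?_, ?_⟩
    · calc ((S.biUnion F).card : ℝ) ≤ ∑ c ∈ S, ((F c).card : ℝ) := by
            exact_mod_cast Finset.card_biUnion_le
        _ ≤ ∑ c ∈ S, ((2 : ℝ) ^ ddim) ^ m := Finset.sum_le_sum fun c _ => hF c
        _ = S.card * ((2 : ℝ) ^ ddim) ^ m := by rw [Finset.sum_const, nsmul_eq_mul]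
        _ ≤ (2 : ℝ) ^ ddim * ((2 : ℝ) ^ ddim) ^ m :=
            mul_le_mul_of_nonneg_right hS (by positivity)
        _ = _ := by rw [pow_succ]; ring
    · rw [pow_succ, mul_comm (2 ^ m : ℝ) 2, mul_assoc]
      intro y hy
      obtain ⟨c, hc, hyc⟩ := Set.mem_iUnion₂.1 (hcov hy)
      obtain ⟨d, hd, hyd⟩ := Set.mem_iUnion₂.1 (hFc c hyc)
      exact Set.mem_iUnion₂.2 ⟨d, Finset.mem_biUnion.2 ⟨c, hc, hd⟩, hyd⟩

/-- A ball of radius `r` contains at most one point of a set whose distances exceed `2 * r`, so the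
covering balls count the set. -/
theorem HasDoublingDimension.card_le_of_separated {X : Type*} [MetricSpace X] {ddim : ℝ}
    (h : HasDoublingDimension X ddim) (m : ℕ) {r : ℝ} (hr : 0 < r) (x : X) (N : Finset X)
    (hN : ∀ p ∈ N, dist p x ≤ 2 ^ m * r) (hsep : ∀ p ∈ N, ∀ q ∈ N, p ≠ q → 2 * r < dist p q) :
    (N.card : ℝ) ≤ ((2 : ℝ) ^ ddim) ^ m := by
  classical
  obtain ⟨S, hS, hcov⟩ := h.exists_cover m hr x
  refine le_trans ?_ hS
  have : ∀ p, ∃ c, p ∈ N → c ∈ S ∧ dist p c ≤ r := by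
    intro p
    by_cases hp : p ∈ N
    · obtain ⟨c, hc, hpc⟩ := Set.mem_iUnion₂.1 (hcov (Metric.mem_closedBall.2 (hN p hp)))
      exact ⟨c, fun _ => ⟨hc, hpc⟩⟩
    · exact ⟨p, fun h => absurd h hp⟩
  choose c hc using this
  have hcard : N.card ≤ S.card := by
    refine Finset.card_le_card_of_injOn c (fun p hp => (hc p hp).1) ?_
    intro p hp q hq hpq
    by_contra hne
    have h1 := (hc p hp).2
    have h2 := (hc q hq).2
    rw [← hpq] at h2
    have := dist_triangle_right p q (c p)
    linarith [hsep p hp q hq hne]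
  exact_mod_cast hcard

open Classical in
theorem NetTree.card_near_le {X : Type*} [MetricSpace X] [Fintype X] {δ ddim : ℝ} (hδ : 0 < δ)
    (T : NetTree X δ) (h : HasDoublingDimension X ddim) (i m : ℕ) (p : X) :
    (((T.net i).filter fun q => dist q p ≤ 2 ^ m * (δ * 2 ^ i)).card : ℝ) ≤
      ((2 : ℝ) ^ ddim) ^ (m + 1) := by
  -- The covering balls have half the scale as radius, which accounts for the exponent `m + 1`.
  refine h.card_le_of_separated (m + 1) (r := δ * 2 ^ i / 2) (by positivity) p _ ?_ ?_
  · intro q hq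
    refine (Finset.mem_filter.1 hq).2.trans (le_of_eq ?_)
    rw [pow_succ]; ring
  · intro a ha b hb hne
    have := T.net_sep (Finset.mem_filter.1 ha).1 (Finset.mem_filter.1 hb).1 hne
    linarith

/-- Around one point of a closest pair, the ball whose radius is their distance contains both
points, while balls of half that radius are singletons. The bound lets constants be absorbed into
powers of `ε ^ (-ddim)`. -/
theorem HasDoublingDimension.one_le {X : Type*} [MetricSpace X] [Fintype X] {ddim : ℝ}
    (h : HasDoublingDimension X ddim) (hX : 2 ≤ Fintype.card X) : 1 ≤ ddim := by
  classical
  have : Nontrivial X := Fintype.one_lt_card_iff_nontrivial.1 hX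
  obtain ⟨a, b, hab⟩ := exists_pair_ne X
  have hne : (Finset.univ.filter fun p : X × X => p.1 ≠ p.2).Nonempty := ⟨(a, b), by simp [hab]⟩
  obtain ⟨⟨x, y⟩, hxy, hmin⟩ := Finset.exists_min_image _ (fun p : X × X => dist p.1 p.2) hne
  simp only [Finset.mem_filter, Finset.mem_univ, true_and, Prod.forall] at hxy hmin
  have hpos := dist_pos.2 hxy
  obtain ⟨S, hS, hcov⟩ := h (dist x y / 2) (by positivity) x
  have hin : ∀ z, dist z x ≤ dist x y → z ∈ S := by
    intro z hz
    have hz' : z ∈ Metric.closedBall x (2 * (dist x y / 2)) := by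
      rw [Metric.mem_closedBall]; linarith
    obtain ⟨c, hc, hzc⟩ := Set.mem_iUnion₂.1 (hcov hz')
    rw [Metric.mem_closedBall] at hzc
    have : z = c := by
      by_contra hne
      linarith [hmin z c hne]
    rwa [this]
  have h2 : 2 ≤ S.card := by
    rw [← Finset.card_pair hxy]
    refine Finset.card_le_card ?_
    intro z hz
    simp only [Finset.mem_insert, Finset.mem_singleton] at hz
    rcases hz with rfl | rfl
    · exact hin _ (by simp)
    · exact hin _ (by rw [dist_comm])
  have h3 : (2 : ℝ) ^ (1 : ℝ) ≤ 2 ^ ddim := by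
    rw [Real.rpow_one]
    exact le_trans (by exact_mod_cast h2) hS
  exact (Real.rpow_le_rpow_left_iff (by norm_num)).1 h3

/-! ### Size classes and random samples -/

/-- The size class of `a`: sizes in the same class agree up to a factor `1 + γ`. -/
noncomputable def sizeClass (γ : ℝ) (a : ℕ) : ℕ := ⌊Real.log a / Real.log (1 + γ)⌋₊

theorem le_of_sizeClass_eq {γ : ℝ} (hγ : 0 < γ) {a b : ℕ} (ha : 1 ≤ a) (hb : 1 ≤ b)
    (h : sizeClass γ a = sizeClass γ b) : (a : ℝ) ≤ (1 + γ) * b := by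
  have hl : 0 < Real.log (1 + γ) := Real.log_pos (by linarith)
  have ha' : (1 : ℝ) ≤ a := by exact_mod_cast ha
  have hb' : (1 : ℝ) ≤ b := by exact_mod_cast hb
  have h1 : Real.log a / Real.log (1 + γ) < sizeClass γ a + 1 := Nat.lt_floor_add_one _
  have h2 : (sizeClass γ b : ℝ) ≤ Real.log b / Real.log (1 + γ) :=
    Nat.floor_le (div_nonneg (Real.log_nonneg hb') hl.le)
  rw [h] at h1
  have h3 : Real.log a / Real.log (1 + γ) < Real.log b / Real.log (1 + γ) + 1 := by linarith
  rw [div_lt_iff₀ hl, add_mul, div_mul_cancel₀ _ hl.ne', one_mul, add_comm,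
    ← Real.log_mul (by linarith) (by linarith)] at h3
  exact ((Real.log_lt_log_iff (by linarith) (by nlinarith)).1 h3).le

theorem sizeClass_mono {γ : ℝ} (hγ : 0 < γ) {a b : ℕ} (ha : 1 ≤ a) (hab : a ≤ b) :
    sizeClass γ a ≤ sizeClass γ b := by
  have hl : 0 < Real.log (1 + γ) := Real.log_pos (by linarith)
  have ha' : (0 : ℝ) < a := by exact_mod_cast ha
  refine Nat.floor_mono (div_le_div_of_nonneg_right ?_ hl.le)
  exact Real.log_le_log ha' (by exact_mod_cast hab)

/-- Independent uniform samples, `s` of them from every nonempty finite set. -/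
noncomputable def sampleSpace (X : Type*) [Fintype X] [DecidableEq X] (s : ℕ) :
    Finset (Finset X → Fin s → X) :=
  -- The empty set samples from the whole space merely to keep the product nonempty.
  Fintype.piFinset fun D => Fintype.piFinset fun _ => if D.Nonempty then D else Finset.univ

section Sampling

variable {X : Type*} [Fintype X] [DecidableEq X] {s : ℕ}

theorem sampleSpace_nonempty [Nonempty X] : (sampleSpace X s).Nonempty := by
  refine Fintype.piFinset_nonempty.2 fun D => Fintype.piFinset_nonempty.2 fun _ => ?_
  split_ifs with h
  · exact h
  · exact Finset.univ_nonempty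

theorem mem_of_mem_sampleSpace {ω : Finset X → Fin s → X} (hω : ω ∈ sampleSpace X s)
    {D : Finset X} (hD : D.Nonempty) (j : Fin s) : ω D j ∈ D := by
  have := Fintype.mem_piFinset.1 (Fintype.mem_piFinset.1 hω D) j
  rwa [if_pos hD] at this

/-- The event constrains only the factors belonging to `D`, where it replaces `D` by `B ∩ D`; all
other factors cancel. -/
theorem card_sampleSpace_filter (B D : Finset X) (hD : D.Nonempty) :
    (((sampleSpace X s).filter fun ω => ∀ j, ω D j ∈ B).card : ℝ) =
      ((B ∩ D).card / D.card : ℝ) ^ s * (sampleSpace X s).card := by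
  have h1 : (sampleSpace X s).filter (fun ω => ∀ j, ω D j ∈ B) =
      Fintype.piFinset fun D' => Fintype.piFinset fun _ : Fin s =>
        if D' = D then B ∩ D else if D'.Nonempty then D' else Finset.univ := by
    ext ω
    simp only [sampleSpace, Finset.mem_filter, Fintype.mem_piFinset]
    constructor
    · rintro ⟨h, hB⟩ D' j
      split_ifs with he hne
      · subst he
        have := h D' j
        rw [if_pos hD] at this
        exact Finset.mem_inter.2 ⟨hB j, this⟩
      · have := h D' j
        rwa [if_pos hne] at this
      · exact Finset.mem_univ _
    · intro h
      refine ⟨fun D' j => ?_, fun j => ?_⟩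
      · have := h D' j
        by_cases he : D' = D
        · subst he
          rw [if_pos rfl] at this
          rw [if_pos hD]
          exact (Finset.mem_inter.1 this).2
        · rwa [if_neg he] at this
      · have := h D j
        rw [if_pos rfl] at this
        exact (Finset.mem_inter.1 this).1
  have hDc : (D.card : ℝ) ≠ 0 := by exact_mod_cast hD.card_pos.ne'
  rw [h1, sampleSpace, Fintype.card_piFinset, Fintype.card_piFinset]
  simp only [Fintype.card_piFinset, Finset.prod_const, Finset.card_univ, Fintype.card_fin]
  rw [← Finset.mul_prod_erase _ _ (Finset.mem_univ D), ← Finset.mul_prod_erase _ _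
    (Finset.mem_univ D), if_pos rfl, if_pos hD]
  have h2 : ∏ x ∈ Finset.univ.erase D,
      (if x = D then B ∩ D else if x.Nonempty then x else Finset.univ).card ^ s =
      ∏ x ∈ Finset.univ.erase D, (if x.Nonempty then x else Finset.univ).card ^ s :=
    Finset.prod_congr rfl fun x hx => by rw [if_neg (Finset.ne_of_mem_erase hx)]
  rw [h2, Nat.cast_mul, Nat.cast_mul, div_pow, Nat.cast_pow, Nat.cast_pow]
  field_simp

end Sampling

/-! ### Shared representatives and faulty points -/

namespace NetTree

variable {X : Type*} [MetricSpace X] {δ : ℝ} [Fintype X] (T : NetTree X δ)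

open Classical in
/-- All clusters of the hierarchy. -/
noncomputable def clusters : Finset (Finset X) :=
  Finset.univ.filter fun A => ∃ i x, A = T.cluster i x

theorem mem_clusters {A : Finset X} : A ∈ T.clusters ↔ ∃ i x, A = T.cluster i x := by
  simp [clusters]

theorem cluster_mem_clusters (i : ℕ) (x : X) : T.cluster i x ∈ T.clusters :=
  T.mem_clusters.2 ⟨i, x, rfl⟩

theorem nonempty_of_mem_clusters {A : Finset X} (hA : A ∈ T.clusters) : A.Nonempty := by
  obtain ⟨i, x, rfl⟩ := T.mem_clusters.1 hA
  exact ⟨x, T.self_mem_cluster i x⟩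

theorem clusters_laminar {A A' : Finset X} (hA : A ∈ T.clusters) (hA' : A' ∈ T.clusters) {z : X}
    (h : z ∈ A) (h' : z ∈ A') : A ⊆ A' ∨ A' ⊆ A := by
  obtain ⟨i, x, rfl⟩ := T.mem_clusters.1 hA
  obtain ⟨j, y, rfl⟩ := T.mem_clusters.1 hA'
  rcases le_total i j with hij | hij
  · exact Or.inl (T.cluster_subset_of_mem hij h h')
  · exact Or.inr (T.cluster_subset_of_mem hij h' h)

/-- Clusters of nearly the same size share their samples through `D`, so that a point meets only as
many sampled sets as there are size classes, however many levels there are. The premise sits inside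
the existential to make `base` a total function. -/
theorem exists_base (γ : ℝ) (A : Finset X) : ∃ D, A ∈ T.clusters →
    D ∈ T.clusters ∧ D ⊆ A ∧ sizeClass γ D.card = sizeClass γ A.card ∧
      ∀ E ∈ T.clusters, E ⊆ A → sizeClass γ E.card = sizeClass γ A.card → D.card ≤ E.card := by
  classical
  by_cases hA : A ∈ T.clusters
  · obtain ⟨D, hD, hmin⟩ := Finset.exists_min_image
      (T.clusters.filter fun E => E ⊆ A ∧ sizeClass γ E.card = sizeClass γ A.card) Finset.card
      ⟨A, Finset.mem_filter.2 ⟨hA, subset_rfl, rfl⟩⟩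
    have hD' := Finset.mem_filter.1 hD
    exact ⟨D, fun _ => ⟨hD'.1, hD'.2.1, hD'.2.2, fun E h1 h2 h3 =>
      hmin E (Finset.mem_filter.2 ⟨h1, h2, h3⟩)⟩⟩
  · exact ⟨A, fun h => absurd h hA⟩

/-- The smallest cluster inside the cluster `A` of the same size class. -/
noncomputable def base (γ : ℝ) (A : Finset X) : Finset X := (T.exists_base γ A).choose

section Base

variable {T} {γ : ℝ} {A A' : Finset X}

theorem base_mem_clusters (hA : A ∈ T.clusters) : T.base γ A ∈ T.clusters :=
  ((T.exists_base γ A).choose_spec hA).1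

theorem base_subset (hA : A ∈ T.clusters) : T.base γ A ⊆ A :=
  ((T.exists_base γ A).choose_spec hA).2.1

theorem sizeClass_base (hA : A ∈ T.clusters) :
    sizeClass γ (T.base γ A).card = sizeClass γ A.card :=
  ((T.exists_base γ A).choose_spec hA).2.2.1

theorem card_base_le (hA : A ∈ T.clusters) {E : Finset X} (hE : E ∈ T.clusters) (hEA : E ⊆ A)
    (h : sizeClass γ E.card = sizeClass γ A.card) : (T.base γ A).card ≤ E.card :=
  ((T.exists_base γ A).choose_spec hA).2.2.2 E hE hEA h

theorem base_nonempty (hA : A ∈ T.clusters) : (T.base γ A).Nonempty :=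
  T.nonempty_of_mem_clusters (base_mem_clusters hA)

theorem card_le_base (hγ : 0 < γ) (hA : A ∈ T.clusters) :
    (A.card : ℝ) ≤ (1 + γ) * (T.base γ A).card :=
  le_of_sizeClass_eq hγ (T.nonempty_of_mem_clusters hA).card_pos (base_nonempty hA).card_pos
    (sizeClass_base hA).symm

/-- Intersecting clusters are nested, and a base contains no smaller cluster of its own size class.
-/
theorem base_eq_of_sizeClass_eq (hA : A ∈ T.clusters) (hA' : A' ∈ T.clusters) {z : X}
    (h : z ∈ T.base γ A) (h' : z ∈ T.base γ A')
    (hc : sizeClass γ (T.base γ A).card = sizeClass γ (T.base γ A').card) :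
    T.base γ A = T.base γ A' := by
  rcases T.clusters_laminar (base_mem_clusters hA) (base_mem_clusters hA') h h' with hs | hs
  · exact Finset.eq_of_subset_of_card_le hs (card_base_le hA' (base_mem_clusters hA)
      (hs.trans (base_subset hA')) (hc.trans (sizeClass_base hA')))
  · exact (Finset.eq_of_subset_of_card_le hs (card_base_le hA (base_mem_clusters hA')
      (hs.trans (base_subset hA)) (hc.symm.trans (sizeClass_base hA)))).symm

end Base

open Classical in
/-- The clusters from which the representatives of some cluster are sampled. -/
noncomputable def bases (γ : ℝ) : Finset (Finset X) := T.clusters.image (T.base γ)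

open Classical in
theorem card_bases_containing_le {γ : ℝ} (hγ : 0 < γ) (b : X) :
    ((T.bases γ).filter fun D => b ∈ D).card ≤ sizeClass γ (Fintype.card X) + 1 := by
  rw [← Finset.card_range (sizeClass γ (Fintype.card X) + 1)]
  refine Finset.card_le_card_of_injOn (fun D => sizeClass γ D.card) ?_ ?_
  · intro D hD
    have hD' := (Finset.mem_filter.1 hD).2
    exact Finset.mem_coe.2 (Finset.mem_range.2 (Nat.lt_succ_of_le
      (sizeClass_mono hγ (Finset.card_pos.2 ⟨b, hD'⟩) (Finset.card_le_univ D))))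
  · intro D hD D' hD' h
    obtain ⟨hD1, hD2⟩ := Finset.mem_filter.1 hD
    obtain ⟨hD1', hD2'⟩ := Finset.mem_filter.1 hD'
    obtain ⟨A, hA, rfl⟩ := Finset.mem_image.1 hD1
    obtain ⟨A', hA', rfl⟩ := Finset.mem_image.1 hD1'
    exact base_eq_of_sizeClass_eq hA hA' hD2 hD2' h

-- All clusters with base `D` contain `D`, hence form a chain, and the largest of them is in the
-- size class of `D`.
open Classical in
theorem card_span_base_le {γ : ℝ} (hγ : 0 < γ) (D : Finset X) :
    ((Finset.univ.filter fun x => ∃ A ∈ T.clusters, x ∈ A ∧ T.base γ A = D).card : ℝ) ≤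
      (1 + γ) * D.card := by
  by_cases h : ∃ A ∈ T.clusters, T.base γ A = D
  · obtain ⟨A, hA, hmax⟩ := Finset.exists_max_image
      (T.clusters.filter fun A => T.base γ A = D) Finset.card
      (by obtain ⟨A, hA, hD⟩ := h; exact ⟨A, Finset.mem_filter.2 ⟨hA, hD⟩⟩)
    obtain ⟨hA1, hA2⟩ := Finset.mem_filter.1 hA
    obtain ⟨z, hz⟩ := base_nonempty (γ := γ) hA1
    have hsub : (Finset.univ.filter fun x => ∃ A ∈ T.clusters, x ∈ A ∧ T.base γ A = D) ⊆ A := by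
      intro x hx
      obtain ⟨A', hA', hxA', hD'⟩ := (Finset.mem_filter.1 hx).2
      have hz' : z ∈ A' := base_subset (γ := γ) hA' (by rw [hD', ← hA2]; exact hz)
      rcases T.clusters_laminar hA1 hA' (base_subset hA1 hz) hz' with hs | hs
      · rw [Finset.eq_of_subset_of_card_le hs (hmax A' (Finset.mem_filter.2 ⟨hA', hD'⟩))]
        exact hxA'
      · exact hs hxA'
    calc _ ≤ (A.card : ℝ) := by exact_mod_cast Finset.card_le_card hsub
      _ ≤ _ := by rw [← hA2]; exact card_le_base hγ hA1
  · have : (Finset.univ.filter fun x => ∃ A ∈ T.clusters, x ∈ A ∧ T.base γ A = D) = ∅ := by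
      rw [Finset.filter_eq_empty_iff]
      rintro x - ⟨A, hA, -, hD⟩
      exact h ⟨A, hA, hD⟩
    rw [this]
    simp only [Finset.card_empty, Nat.cast_zero]
    positivity

open Classical in
/-- The points in clusters that are almost entirely attacked. -/
noncomputable def densePoints (γ : ℝ) (B : Finset X) : Finset X :=
  Finset.univ.filter fun x => ∃ A ∈ T.clusters, x ∈ A ∧
    (1 - γ) * (T.base γ A).card < ((B ∩ T.base γ A).card : ℝ)

/-- The maximal clusters with an almost fully attacked base are disjoint and cover all dense points.
Each is attacked in at least a fraction `1 - 2γ` of its points, since it exceeds its base by a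
factor of at most `1 + γ`. -/
theorem card_densePoints_le {γ : ℝ} (hγ : 0 < γ) (hγ' : γ < 1 / 2) (B : Finset X) :
    (1 - 2 * γ) * (T.densePoints γ B).card ≤ B.card := by
  classical
  set P : Finset (Finset X) := T.clusters.filter fun A =>
    (1 - γ) * (T.base γ A).card < ((B ∩ T.base γ A).card : ℝ) with hP
  have hE : ∀ x, ∃ E, x ∈ T.densePoints γ B →
      E ∈ P ∧ x ∈ E ∧ ∀ A ∈ P, x ∈ A → A.card ≤ E.card := by
    intro x
    by_cases hx : x ∈ T.densePoints γ B
    · obtain ⟨A, hA, hxA, hd⟩ := (Finset.mem_filter.1 hx).2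
      obtain ⟨E, hE, hmax⟩ := Finset.exists_max_image (P.filter fun A => x ∈ A) Finset.card
        ⟨A, Finset.mem_filter.2 ⟨Finset.mem_filter.2 ⟨hA, hd⟩, hxA⟩⟩
      obtain ⟨h1, h2⟩ := Finset.mem_filter.1 hE
      exact ⟨E, fun _ => ⟨h1, h2, fun A hA hxA => hmax A (Finset.mem_filter.2 ⟨hA, hxA⟩)⟩⟩
    · exact ⟨∅, fun h => absurd h hx⟩
  choose E hE using hE
  set M := (T.densePoints γ B).image E with hM
  have hdisj : ∀ A ∈ M, ∀ A' ∈ M, A ≠ A' → Disjoint A A' := by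
    intro A hA A' hA' hne
    obtain ⟨x, hx, rfl⟩ := Finset.mem_image.1 hA
    obtain ⟨y, hy, rfl⟩ := Finset.mem_image.1 hA'
    rw [Finset.disjoint_left]
    intro z hz hz'
    obtain ⟨hx1, hx2, hx3⟩ := hE x hx
    obtain ⟨hy1, hy2, hy3⟩ := hE y hy
    rcases T.clusters_laminar (Finset.mem_filter.1 hx1).1 (Finset.mem_filter.1 hy1).1 hz hz'
      with hs | hs
    · exact hne (Finset.eq_of_subset_of_card_le hs (hx3 _ hy1 (hs hx2)))
    · exact hne (Finset.eq_of_subset_of_card_le hs (hy3 _ hx1 (hs hy2))).symm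
  have hcov : T.densePoints γ B ⊆ M.biUnion id := fun x hx =>
    Finset.mem_biUnion.2 ⟨E x, Finset.mem_image_of_mem _ hx, (hE x hx).2.1⟩
  have hMP : ∀ A ∈ M, (1 - 2 * γ) * A.card ≤ ((B ∩ A).card : ℝ) := by
    intro A hA
    obtain ⟨x, hx, rfl⟩ := Finset.mem_image.1 hA
    obtain ⟨h1, h2⟩ := Finset.mem_filter.1 (hE x hx).1
    have h3 := card_le_base hγ h1
    have h4 : ((B ∩ T.base γ (E x)).card : ℝ) ≤ (B ∩ E x).card := by
      exact_mod_cast Finset.card_le_card (Finset.inter_subset_inter_left (base_subset h1))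
    have h5 : (0 : ℝ) ≤ (T.base γ (E x)).card := Nat.cast_nonneg _
    -- This uses `(1 - 2γ) * (1 + γ) ≤ 1 - γ`.
    nlinarith [mul_le_mul_of_nonneg_left h3 (by linarith : (0 : ℝ) ≤ 1 - 2 * γ),
      mul_nonneg (mul_nonneg hγ.le hγ.le) h5]
  calc (1 - 2 * γ) * ((T.densePoints γ B).card : ℝ)
      ≤ (1 - 2 * γ) * ∑ A ∈ M, (A.card : ℝ) := by
        refine mul_le_mul_of_nonneg_left ?_ (by linarith)
        exact_mod_cast (Finset.card_le_card hcov).trans Finset.card_biUnion_le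
    _ = ∑ A ∈ M, (1 - 2 * γ) * A.card := Finset.mul_sum _ _ _
    _ ≤ ∑ A ∈ M, ((B ∩ A).card : ℝ) := Finset.sum_le_sum hMP
    _ = ((M.biUnion fun A => B ∩ A).card : ℝ) := by
        rw [Finset.card_biUnion]
        · push_cast; rfl
        · intro A hA A' hA' hne
          exact (hdisj A hA A' hA' hne).mono Finset.inter_subset_right Finset.inter_subset_right
    _ ≤ B.card := by
        exact_mod_cast Finset.card_le_card (Finset.biUnion_subset.2 fun A _ =>
          Finset.inter_subset_left)

open Classical in
/-- The points with a cluster all of whose representatives are attacked. -/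
noncomputable def faulty (γ : ℝ) {s : ℕ} (ω : Finset X → Fin s → X) (B : Finset X) : Finset X :=
  Finset.univ.filter fun x => ∃ A ∈ T.clusters, x ∈ A ∧ ∀ j, ω (T.base γ A) j ∈ B

-- Points outside the dense part are faulty only through a base `D` with at least a fraction `γ`
-- unattacked. Of its `s + 1` samples, `s` contribute the factor `(1 - γ) ^ s`, and the last
-- contributes `|B ∩ D| / |D|`, which turns the at most `(1 + γ) |D|` spoiled points into a multiple
-- of `|B ∩ D|`. Double counting over the bases at each attacked point finishes.
open Classical in
theorem sum_card_faulty_le {γ : ℝ} (hγ : 0 < γ) (hγ' : γ < 1 / 2) (s : ℕ) (B : Finset X) :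
    ∑ ω ∈ sampleSpace X (s + 1), ((T.faulty γ ω B).card : ℝ) ≤
      (1 / (1 - 2 * γ) + (1 + γ) * (1 - γ) ^ s * (sizeClass γ (Fintype.card X) + 1)) * B.card *
        (sampleSpace X (s + 1)).card := by
  set Ω := sampleSpace X (s + 1) with hΩ
  set P := (T.bases γ).filter fun D => ((B ∩ D).card : ℝ) ≤ (1 - γ) * D.card with hP
  set span : Finset X → Finset X := fun D =>
    Finset.univ.filter fun x => ∃ A ∈ T.clusters, x ∈ A ∧ T.base γ A = D with hspan
  have hone : ∀ ω : Finset X → Fin (s + 1) → X, ((T.faulty γ ω B).card : ℝ) ≤ (T.densePoints γ B).card +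
      ∑ D ∈ P, (1 + γ) * D.card * (if ∀ j, ω D j ∈ B then 1 else 0) := by
    intro ω
    have hsub : T.faulty γ ω B ⊆ T.densePoints γ B ∪
        (P.filter fun D => ∀ j, ω D j ∈ B).biUnion span := by
      intro x hx
      obtain ⟨A, hA, hxA, hj⟩ := (Finset.mem_filter.1 hx).2
      rw [Finset.mem_union]
      by_cases hd : (1 - γ) * (T.base γ A).card < ((B ∩ T.base γ A).card : ℝ)
      · exact Or.inl (Finset.mem_filter.2 ⟨Finset.mem_univ _, A, hA, hxA, hd⟩)
      · refine Or.inr (Finset.mem_biUnion.2 ⟨T.base γ A, Finset.mem_filter.2 ⟨?_, hj⟩, ?_⟩)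
        · exact Finset.mem_filter.2 ⟨Finset.mem_image_of_mem _ hA, not_lt.1 hd⟩
        · exact Finset.mem_filter.2 ⟨Finset.mem_univ _, A, hA, hxA, rfl⟩
    have h1 : (T.faulty γ ω B).card ≤ (T.densePoints γ B).card +
        ∑ D ∈ P.filter (fun D => ∀ j, ω D j ∈ B), (span D).card :=
      (Finset.card_le_card hsub).trans ((Finset.card_union_le _ _).trans
        (Nat.add_le_add_left Finset.card_biUnion_le _))
    calc ((T.faulty γ ω B).card : ℝ) ≤ (T.densePoints γ B).card +
        ∑ D ∈ P.filter (fun D => ∀ j, ω D j ∈ B), ((span D).card : ℝ) := by exact_mod_cast h1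
      _ ≤ (T.densePoints γ B).card +
        ∑ D ∈ P.filter (fun D => ∀ j, ω D j ∈ B), (1 + γ) * D.card := by
          gcongr with D _
          exact T.card_span_base_le hγ D
      _ = _ := by
          rw [Finset.sum_filter]
          congr 1
          refine Finset.sum_congr rfl fun D _ => ?_
          split_ifs <;> simp
  have hprob : ∀ D ∈ P, ∑ ω ∈ Ω, (1 + γ) * D.card * (if ∀ j, ω D j ∈ B then (1 : ℝ) else 0) ≤
      (1 + γ) * (1 - γ) ^ s * Ω.card * (B ∩ D).card := by
    intro D hD
    obtain ⟨hD1, hD2⟩ := Finset.mem_filter.1 hD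
    obtain ⟨A, hA, rfl⟩ := Finset.mem_image.1 hD1
    have hne := base_nonempty (γ := γ) hA
    have hpos : (0 : ℝ) < (T.base γ A).card := by exact_mod_cast hne.card_pos
    rw [← Finset.mul_sum, Finset.sum_boole, card_sampleSpace_filter B _ hne, pow_succ]
    have hr : ((B ∩ T.base γ A).card / (T.base γ A).card : ℝ) ^ s ≤ (1 - γ) ^ s := by
      refine pow_le_pow_left₀ (by positivity) ?_ s
      rwa [div_le_iff₀ hpos]
    calc _ = (1 + γ) * ((B ∩ T.base γ A).card / (T.base γ A).card : ℝ) ^ s * Ω.card *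
        (B ∩ T.base γ A).card := by rw [hΩ]; field_simp
      _ ≤ _ := by gcongr
  have hcount : ∑ D ∈ P, ((B ∩ D).card : ℝ) ≤ (sizeClass γ (Fintype.card X) + 1) * B.card := by
    calc ∑ D ∈ P, ((B ∩ D).card : ℝ) ≤ ∑ D ∈ T.bases γ, ((B ∩ D).card : ℝ) :=
          Finset.sum_le_sum_of_subset_of_nonneg (Finset.filter_subset _ _)
            fun _ _ _ => Nat.cast_nonneg _
      _ = ∑ D ∈ T.bases γ, ∑ b ∈ B, (if b ∈ D then (1 : ℝ) else 0) := by
          refine Finset.sum_congr rfl fun D _ => ?_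
          rw [Finset.sum_boole, Finset.filter_mem_eq_inter]
      _ = ∑ b ∈ B, (((T.bases γ).filter fun D => b ∈ D).card : ℝ) := by
          rw [Finset.sum_comm]
          exact Finset.sum_congr rfl fun b _ => Finset.sum_boole _ _
      _ ≤ ∑ b ∈ B, ((sizeClass γ (Fintype.card X) + 1 : ℕ) : ℝ) :=
          Finset.sum_le_sum fun b _ => by exact_mod_cast T.card_bases_containing_le hγ b
      _ = _ := by rw [Finset.sum_const, nsmul_eq_mul]; push_cast; ring
  have hdense : ((T.densePoints γ B).card : ℝ) ≤ 1 / (1 - 2 * γ) * B.card := by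
    rw [one_div, inv_mul_eq_div, le_div_iff₀ (by linarith), mul_comm]
    exact T.card_densePoints_le hγ hγ' B
  calc _ ≤ ∑ ω ∈ Ω, (((T.densePoints γ B).card : ℝ) +
      ∑ D ∈ P, (1 + γ) * D.card * (if ∀ j, ω D j ∈ B then 1 else 0)) :=
        Finset.sum_le_sum fun ω _ => hone ω
    _ = Ω.card * (T.densePoints γ B).card +
      ∑ D ∈ P, ∑ ω ∈ Ω, (1 + γ) * D.card * (if ∀ j, ω D j ∈ B then (1 : ℝ) else 0) := by
        rw [Finset.sum_add_distrib, Finset.sum_const, nsmul_eq_mul, Finset.sum_comm]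
    _ ≤ Ω.card * (1 / (1 - 2 * γ) * B.card) +
      ∑ D ∈ P, (1 + γ) * (1 - γ) ^ s * Ω.card * (B ∩ D).card := by
        gcongr with D hD
        exact hprob D hD
    _ = Ω.card * (1 / (1 - 2 * γ) * B.card) +
      (1 + γ) * (1 - γ) ^ s * Ω.card * ∑ D ∈ P, ((B ∩ D).card : ℝ) := by rw [Finset.mul_sum]
    _ ≤ Ω.card * (1 / (1 - 2 * γ) * B.card) +
      (1 + γ) * (1 - γ) ^ s * Ω.card * ((sizeClass γ (Fintype.card X) + 1) * B.card) := by
        gcongr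
        have : 0 ≤ (1 - γ) ^ s := pow_nonneg (by linarith) s
        positivity
    _ = _ := by ring

end NetTree

/-! ### Joined pairs of clusters: number and scales -/

theorem sum_biUnion_le_of_nonneg {α ι : Type*} [DecidableEq α] (s : Finset ι) (t : ι → Finset α)
    (f : α → ℝ) (hf : ∀ a, 0 ≤ f a) :
    ∑ a ∈ s.biUnion t, f a ≤ ∑ i ∈ s, ∑ a ∈ t i, f a := by
  classical
  induction s using Finset.induction_on with
  | empty => simp
  | insert i s hi ih =>
    rw [Finset.biUnion_insert, Finset.sum_insert hi]
    have := Finset.sum_union_inter (f := f) (s₁ := t i) (s₂ := s.biUnion t)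
    have h0 : 0 ≤ ∑ a ∈ t i ∩ s.biUnion t, f a := Finset.sum_nonneg fun a _ => hf a
    linarith

theorem sum_image_le_of_forall_nonneg {α ι : Type*} [DecidableEq α] (s : Finset ι) (g : ι → α)
    (f : α → ℝ) (hf : ∀ a, 0 ≤ f a) : ∑ a ∈ s.image g, f a ≤ ∑ i ∈ s, f (g i) := by
  have h : s.image g = s.biUnion fun i => {g i} := by ext; simp [eq_comm]
  rw [h]
  refine (sum_biUnion_le_of_nonneg s _ f hf).trans (le_of_eq ?_)
  simp

namespace NetTree

variable {X : Type*} [MetricSpace X] {δ : ℝ} [Fintype X] (T : NetTree X δ)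

open Classical in
/-- Pairs of distinct net points of level `i` at distance at most `2 ^ m` times the scale. -/
noncomputable def crossing (m i : ℕ) : Finset (X × X) :=
  (T.net i ×ˢ T.net i).filter fun p => p.1 ≠ p.2 ∧ dist p.1 p.2 ≤ 2 ^ m * (δ * 2 ^ i)

open Classical in
/-- The pairs of clusters of level `i` whose representatives are joined. -/
noncomputable def pairs (m i : ℕ) : Finset (Finset X × Finset X) :=
  (T.crossing m i).image (fun p => (T.cluster i p.1, T.cluster i p.2)) ∪
    ((T.net i \ T.net (i + 1)).image (fun q => (T.cluster i q, T.cluster (i + 1) q)) ∪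
      (T.net i \ T.net (i + 1)).image
        (fun q => (T.cluster i (T.anc (i + 1) q), T.cluster (i + 1) q)))

theorem mem_pairs_of_anc_ne {m i : ℕ} {x y : X} (hne : T.anc i x ≠ T.anc i y)
    (hd : dist (T.anc i x) (T.anc i y) ≤ 2 ^ m * (δ * 2 ^ i)) :
    (T.cluster i x, T.cluster i y) ∈ T.pairs m i := by
  classical
  refine Finset.mem_union_left _ (Finset.mem_image.2 ⟨(T.anc i x, T.anc i y), ?_, ?_⟩)
  · exact Finset.mem_filter.2 ⟨Finset.mem_product.2 ⟨T.anc_mem_net i x, T.anc_mem_net i y⟩, hne, hd⟩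
  · exact Prod.ext (T.cluster_eq_iff.2 (T.anc_anc i x)) (T.cluster_eq_iff.2 (T.anc_anc i y))

/-- Parent links are created only at net points that die, since otherwise their number would grow
with the number of levels. If the ancestor of `x` itself survives but its cluster grows, some
sibling died, and the link is the one recorded for that sibling. -/
theorem mem_pairs_of_cluster_ne (m : ℕ) {i : ℕ} {x : X}
    (hne : T.cluster i x ≠ T.cluster (i + 1) x) :
    (T.cluster i x, T.cluster (i + 1) x) ∈ T.pairs m i ∧ ∃ q, q ∈ T.net i ∧ q ∉ T.net (i + 1) := by
  classical
  have hc1 : ∀ y, T.cluster i (T.anc i y) = T.cluster i y := fun y =>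
    T.cluster_eq_iff.2 (T.anc_anc i y)
  have hc2 : ∀ y, T.cluster (i + 1) (T.anc i y) = T.cluster (i + 1) y := fun y =>
    T.cluster_eq_iff.2 (T.anc_succ_anc i y)
  by_cases hp : T.anc i x ∈ T.net (i + 1)
  · obtain ⟨y, hy, hyx⟩ := Finset.exists_of_ssubset
      (lt_of_le_of_ne (T.cluster_subset (Nat.le_succ i) x) hne)
    rw [mem_cluster] at hy hyx
    have hx : T.anc (i + 1) x = T.anc i x := by
      rw [← T.anc_succ_anc]; exact T.mem_net.1 hp
    have hq : T.anc i y ∉ T.net (i + 1) := by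
      intro h
      have : T.anc (i + 1) y = T.anc i y := by
        rw [← T.anc_succ_anc]; exact T.mem_net.1 h
      exact hyx (by rw [← this, hy, hx])
    refine ⟨Finset.mem_union_right _ (Finset.mem_union_right _ (Finset.mem_image.2
      ⟨T.anc i y, Finset.mem_sdiff.2 ⟨T.anc_mem_net i y, hq⟩, ?_⟩)), T.anc i y,
      T.anc_mem_net i y, hq⟩
    refine Prod.ext ?_ ?_
    · dsimp only
      rw [T.anc_succ_anc, hy, hx, hc1]
    · dsimp only
      rw [hc2, T.cluster_eq_iff, hy]
  · exact ⟨Finset.mem_union_right _ (Finset.mem_union_left _ (Finset.mem_image.2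
      ⟨T.anc i x, Finset.mem_sdiff.2 ⟨T.anc_mem_net i x, hp⟩, Prod.ext (hc1 x) (hc2 x)⟩)),
      T.anc i x, T.anc_mem_net i x, hp⟩

theorem mem_clusters_of_mem_pairs {m i : ℕ} {P : Finset X × Finset X} (hP : P ∈ T.pairs m i) :
    P.1 ∈ T.clusters ∧ P.2 ∈ T.clusters := by
  classical
  simp only [pairs, Finset.mem_union, Finset.mem_image] at hP
  rcases hP with ⟨p, -, rfl⟩ | ⟨q, -, rfl⟩ | ⟨q, -, rfl⟩ <;>
    exact ⟨T.cluster_mem_clusters _ _, T.cluster_mem_clusters _ _⟩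

theorem dist_le_of_mem_pairs (hδ : 0 ≤ δ) {m i : ℕ} {P : Finset X × Finset X}
    (hP : P ∈ T.pairs m i) {a b : X} (ha : a ∈ P.1) (hb : b ∈ P.2) :
    dist a b ≤ (2 ^ m + 8) * (δ * 2 ^ i) := by
  classical
  have hΔ : 0 ≤ δ * 2 ^ i := by positivity
  have hmΔ : 0 ≤ 2 ^ m * (δ * 2 ^ i) := by positivity
  have hpar : ∀ x, a ∈ T.cluster i x → b ∈ T.cluster (i + 1) x →
      dist a b ≤ (2 ^ m + 8) * (δ * 2 ^ i) := by
    intro x ha hb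
    have := T.dist_le_of_mem_cluster hδ (T.cluster_subset (Nat.le_succ i) x ha) hb
    rw [pow_succ] at this
    linarith
  simp only [pairs, Finset.mem_union, Finset.mem_image] at hP
  rcases hP with ⟨⟨p, q⟩, hpq, rfl⟩ | ⟨q, hq, rfl⟩ | ⟨q, hq, rfl⟩
  · obtain ⟨hpq1, -, hd⟩ := Finset.mem_filter.1 hpq
    have h1 := T.dist_le_of_mem_cluster hδ ha (T.self_mem_cluster i p)
    have h2 := T.dist_le_of_mem_cluster hδ (T.self_mem_cluster i q) hb
    have t := dist_triangle4 a p q b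
    dsimp only at hd
    linarith
  · exact hpar q ha hb
  · refine hpar (T.anc (i + 1) q) ha ?_
    rwa [T.cluster_eq_iff.2 (T.anc_anc (i + 1) q)]

-- Two points of the net of level `i + m` are more than `2 ^ m` scales of level `i` apart, so each
-- crossing pair has an end outside that net; that end has at most `((2 : ℝ) ^ ddim) ^ (m + 1)`
-- neighbours. Parent links add two for each dying point.
open Classical in
theorem card_pairs_le (hδ : 0 < δ) {ddim : ℝ} (hd : HasDoublingDimension X ddim)
    (h1 : 1 ≤ ddim) {m : ℕ} (hm : 1 ≤ m) (i : ℕ) :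
    ((T.pairs m i).card : ℝ) ≤
      4 * ((2 : ℝ) ^ ddim) ^ (m + 1) * (T.net i \ T.net (i + m)).card := by
  set Q := ((2 : ℝ) ^ ddim) ^ (m + 1) with hQ
  set K := T.net i \ T.net (i + m) with hK
  have hQ1 : 1 ≤ Q := one_le_pow₀ (Real.one_le_rpow (by norm_num) (by linarith))
  set near : X → Finset X := fun p => (T.net i).filter fun q => dist q p ≤ 2 ^ m * (δ * 2 ^ i)
  have hnear : ∀ p, ((near p).card : ℝ) ≤ Q := fun p => T.card_near_le hδ hd i m p
  have hpar : (T.net i \ T.net (i + 1)).card ≤ K.card :=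
    Finset.card_le_card (Finset.sdiff_subset_sdiff subset_rfl (T.net_antitone (by omega)))
  have hsub : T.crossing m i ⊆ (K.biUnion fun p => (near p).image fun q => (p, q)) ∪
      K.biUnion fun p => (near p).image fun q => (q, p) := by
    rintro ⟨p, q⟩ hpq
    obtain ⟨hmem, hne, hle⟩ := Finset.mem_filter.1 hpq
    obtain ⟨hp, hq⟩ := Finset.mem_product.1 hmem
    dsimp only at hp hq hne hle
    rw [Finset.mem_union]
    by_cases hpK : p ∈ T.net (i + m)
    · have hqK : q ∉ T.net (i + m) := by
        intro hqK
        have := T.net_sep hpK hqK hne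
        rw [pow_add] at this
        linarith
      refine Or.inr (Finset.mem_biUnion.2 ⟨q, Finset.mem_sdiff.2 ⟨hq, hqK⟩,
        Finset.mem_image.2 ⟨p, Finset.mem_filter.2 ⟨hp, hle⟩, rfl⟩⟩)
    · refine Or.inl (Finset.mem_biUnion.2 ⟨p, Finset.mem_sdiff.2 ⟨hp, hpK⟩,
        Finset.mem_image.2 ⟨q, Finset.mem_filter.2 ⟨hq, by rwa [dist_comm]⟩, rfl⟩⟩)
  have hbi : ∀ g : X → X → X × X,
      ((K.biUnion fun p => (near p).image (g p)).card : ℝ) ≤ K.card * Q := by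
    intro g
    calc ((K.biUnion fun p => (near p).image (g p)).card : ℝ)
        ≤ ∑ p ∈ K, (((near p).image (g p)).card : ℝ) := by exact_mod_cast Finset.card_biUnion_le
      _ ≤ ∑ p ∈ K, Q := Finset.sum_le_sum fun p _ =>
          le_trans (by exact_mod_cast Finset.card_image_le) (hnear p)
      _ = _ := by rw [Finset.sum_const, nsmul_eq_mul]
  have hcross : ((T.crossing m i).card : ℝ) ≤ 2 * (K.card * Q) := by
    have h := (Finset.card_le_card hsub).trans (Finset.card_union_le _ _)
    have h' : ((T.crossing m i).card : ℝ) ≤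
        (K.biUnion fun p => (near p).image fun q => (p, q)).card +
        (K.biUnion fun p => (near p).image fun q => (q, p)).card := by exact_mod_cast h
    linarith [hbi fun p q => (p, q), hbi fun p q => (q, p)]
  have hall : (T.pairs m i).card ≤ (T.crossing m i).card +
      ((T.net i \ T.net (i + 1)).card + (T.net i \ T.net (i + 1)).card) :=
    (Finset.card_union_le _ _).trans (Nat.add_le_add Finset.card_image_le
      ((Finset.card_union_le _ _).trans (Nat.add_le_add Finset.card_image_le
        Finset.card_image_le)))
  have hall' : ((T.pairs m i).card : ℝ) ≤ (T.crossing m i).card + (K.card + K.card) := by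
    have : (T.pairs m i).card ≤ (T.crossing m i).card + (K.card + K.card) := by omega
    exact_mod_cast this
  have hK0 : (0 : ℝ) ≤ K.card := Nat.cast_nonneg _
  nlinarith

theorem two_le_card_net {i : ℕ} {p q : X} (hp : p ∈ T.net i) (hq : q ∈ T.net i) (h : p ≠ q) :
    2 ≤ (T.net i).card := Finset.one_lt_card.2 ⟨p, hp, q, hq, h⟩

theorem two_le_card_net_of_notMem {i j : ℕ} (hij : i ≤ j) {q : X} (hq : q ∈ T.net i)
    (hq' : q ∉ T.net j) : 2 ≤ (T.net i).card :=
  T.two_le_card_net hq (T.net_antitone hij (T.anc_mem_net j q))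
    fun h => hq' (by rw [h]; exact T.anc_mem_net j q)

theorem card_net_mul_le (hδ : 0 ≤ δ) {i : ℕ} (h : 2 ≤ (T.net i).card) :
    (T.net i).card * (δ * 2 ^ i) ≤ 2 * mstWeight X := by
  have := card_mul_le_mstWeight (T.net i) (δ * 2 ^ i) (by positivity) h
    fun p hp q hq hne => (T.net_sep hp hq hne).le
  linarith

theorem scale_le_mstWeight (hδ : 0 ≤ δ) {i : ℕ} (h : 2 ≤ (T.net i).card) :
    δ * 2 ^ i ≤ mstWeight X := by
  have h1 := T.card_net_mul_le hδ h
  have h2 : (2 : ℝ) ≤ (T.net i).card := by exact_mod_cast h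
  have h3 : 0 ≤ δ * 2 ^ i := by positivity
  nlinarith

-- The differences `|N i| - |N (i + m)|` telescope, leaving at most the first `m` nets.
open Classical in
theorem sum_card_net_sdiff_le (m M : ℕ) :
    ∑ i ∈ Finset.range M, (T.net i \ T.net (i + m)).card ≤ m * Fintype.card X := by
  have hle : ∀ i, (T.net i).card ≤ Fintype.card X := fun i => Finset.card_le_univ _
  have h1 : ∑ i ∈ Finset.range M, (T.net i \ T.net (i + m)).card +
      ∑ i ∈ Finset.range M, (T.net (m + i)).card = ∑ i ∈ Finset.range M, (T.net i).card := by
    rw [← Finset.sum_add_distrib]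
    refine Finset.sum_congr rfl fun i _ => ?_
    rw [add_comm m i]
    exact Finset.card_sdiff_add_card_eq_card (T.net_antitone (Nat.le_add_right i m))
  have h2 : ∑ i ∈ Finset.range M, (T.net i).card ≤ ∑ i ∈ Finset.range (m + M), (T.net i).card :=
    Finset.sum_le_sum_of_subset (Finset.range_mono (by omega))
  have h3 : ∑ i ∈ Finset.range m, (T.net i).card ≤ m * Fintype.card X := by
    simpa using Finset.sum_le_sum fun i (_ : i ∈ Finset.range m) => hle i
  rw [Finset.sum_range_add] at h2
  omega

end NetTree

/-- The top `l` levels contribute at most `2 * W` each. Below them the scales are smaller than the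
top scale by `2 ^ l ≥ n`, and the geometric sum of `n * (δ * 2 ^ i)` is at most `2 * W` in total. -/
theorem sum_le_of_le_geometric (a : ℕ → ℝ) {W δ : ℝ} (hδ : 0 ≤ δ) (n M l : ℕ)
    (hW : 0 ≤ W)
    (h1 : ∀ i < M, a i ≤ 2 * W) (h2 : ∀ i < M, a i ≤ n * (δ * 2 ^ i)) (h3 : ∀ i < M, δ * 2 ^ i ≤ W)
    (hn : n ≤ 2 ^ l) : ∑ i ∈ Finset.range M, a i ≤ 2 * W * (l + 1) := by
  rcases le_or_gt M l with h | h
  · calc ∑ i ∈ Finset.range M, a i ≤ ∑ i ∈ Finset.range M, 2 * W :=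
          Finset.sum_le_sum fun i hi => h1 i (Finset.mem_range.1 hi)
      _ = M * (2 * W) := by rw [Finset.sum_const, nsmul_eq_mul, Finset.card_range]
      _ ≤ l * (2 * W) := by gcongr
      _ ≤ _ := by linarith
  · obtain ⟨k, rfl⟩ : ∃ k, M = k + 1 + l := ⟨M - l - 1, by omega⟩
    rw [Finset.sum_range_add]
    have e1 : ∑ i ∈ Finset.range (k + 1), a i ≤ 2 * W := by
      have hgeo : ∑ i ∈ Finset.range (k + 1), (2 : ℝ) ^ i ≤ 2 ^ (k + 1) := by
        rw [geom_sum_eq (by norm_num)]; norm_num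
      have hn' : (n : ℝ) ≤ 2 ^ l := by exact_mod_cast hn
      calc ∑ i ∈ Finset.range (k + 1), a i ≤ ∑ i ∈ Finset.range (k + 1), n * (δ * 2 ^ i) :=
            Finset.sum_le_sum fun i hi => h2 i (by have := Finset.mem_range.1 hi; omega)
        _ = n * (δ * ∑ i ∈ Finset.range (k + 1), (2 : ℝ) ^ i) := by
            rw [Finset.mul_sum, Finset.mul_sum]
        _ ≤ 2 ^ l * (δ * 2 ^ (k + 1)) := by gcongr
        _ = 2 * (δ * 2 ^ (k + l)) := by ring
        _ ≤ 2 * W := by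
            have := h3 (k + l) (by omega)
            linarith
    have e2 : ∑ i ∈ Finset.range l, a (k + 1 + i) ≤ l * (2 * W) := by
      calc _ ≤ ∑ i ∈ Finset.range l, 2 * W :=
            Finset.sum_le_sum fun i hi => h1 _ (by have := Finset.mem_range.1 hi; omega)
        _ = _ := by rw [Finset.sum_const, nsmul_eq_mul, Finset.card_range]
    linarith

/-! ### The random spanner: cost and stretch -/

namespace NetTree

variable {X : Type*} [MetricSpace X] {δ : ℝ} [Fintype X] (T : NetTree X δ)

open Classical in
/-- The edges between the representatives of all joined pairs of clusters below level `M`. -/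
noncomputable def edges (γ : ℝ) (m M : ℕ) {s : ℕ} (ω : Finset X → Fin s → X) : Finset (Sym2 X) :=
  (Finset.range M).biUnion fun i => (T.pairs m i).biUnion fun P =>
    (Finset.univ : Finset (Fin s × Fin s)).image fun jk =>
      s(ω (T.base γ P.1) jk.1, ω (T.base γ P.2) jk.2)

/-- The spanner given by the samples `ω`. -/
noncomputable def spanner (γ : ℝ) (m M : ℕ) {s : ℕ} (ω : Finset X → Fin s → X) :
    WeightedGraph X :=
  WeightedGraph.ofMetric (SimpleGraph.fromEdgeSet (T.edges γ m M ω : Set (Sym2 X)))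

section Cost

variable (γ : ℝ) (m M : ℕ) {s : ℕ} (ω : Finset X → Fin s → X)

theorem size_spanner_le :
    (T.spanner γ m M ω).size ≤ s ^ 2 * ∑ i ∈ Finset.range M, (T.pairs m i).card := by
  classical
  have h1 : (T.spanner γ m M ω).graph.edgeSet ⊆ (T.edges γ m M ω : Set (Sym2 X)) := by
    intro e he
    have he' : e ∈ (SimpleGraph.fromEdgeSet (T.edges γ m M ω : Set (Sym2 X))).edgeSet := he
    rw [SimpleGraph.edgeSet_fromEdgeSet] at he'
    exact he'.1
  calc (T.spanner γ m M ω).size ≤ (T.edges γ m M ω : Set (Sym2 X)).ncard :=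
        Set.ncard_le_ncard h1 (Finset.finite_toSet _)
    _ = (T.edges γ m M ω).card := Set.ncard_coe_finset _
    _ ≤ ∑ i ∈ Finset.range M, ∑ P ∈ T.pairs m i, s ^ 2 := by
        refine Finset.card_biUnion_le.trans (Finset.sum_le_sum fun i _ => ?_)
        refine Finset.card_biUnion_le.trans (Finset.sum_le_sum fun P _ => ?_)
        refine Finset.card_image_le.trans (le_of_eq ?_)
        simp [sq]
    _ = _ := by
        rw [Finset.mul_sum]
        exact Finset.sum_congr rfl fun i _ => by rw [Finset.sum_const, smul_eq_mul, mul_comm]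

variable {ω}

open Classical in
theorem totalWeight_spanner_le (hδ : 0 ≤ δ) (hω : ω ∈ sampleSpace X s) :
    (T.spanner γ m M ω).totalWeight ≤
      s ^ 2 * (2 ^ m + 8) * ∑ i ∈ Finset.range M, (T.pairs m i).card * (δ * 2 ^ i) := by
  set wt : Sym2 X → ℝ := fun e => ((T.spanner γ m M ω).weight e : ℝ) with hwt
  have hnn : ∀ e, 0 ≤ wt e := fun e => NNReal.coe_nonneg _
  rw [WeightedGraph.totalWeight_eq_sum]
  calc _ ≤ ∑ e ∈ T.edges γ m M ω, wt e := by
        refine Finset.sum_le_sum_of_subset_of_nonneg ?_ fun e _ _ => hnn e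
        intro e he
        have he' : e ∈ (SimpleGraph.fromEdgeSet (T.edges γ m M ω : Set (Sym2 X))).edgeSet :=
          (Set.Finite.mem_toFinset _).1 he
        rw [SimpleGraph.edgeSet_fromEdgeSet] at he'
        exact he'.1
    _ ≤ ∑ i ∈ Finset.range M, ∑ P ∈ T.pairs m i, ∑ jk : Fin s × Fin s,
          wt s(ω (T.base γ P.1) jk.1, ω (T.base γ P.2) jk.2) := by
        refine (sum_biUnion_le_of_nonneg _ _ _ hnn).trans (Finset.sum_le_sum fun i _ => ?_)
        refine (sum_biUnion_le_of_nonneg _ _ _ hnn).trans (Finset.sum_le_sum fun P _ => ?_)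
        exact sum_image_le_of_forall_nonneg _ _ _ hnn
    _ ≤ ∑ i ∈ Finset.range M, ∑ P ∈ T.pairs m i, ∑ jk : Fin s × Fin s,
          (2 ^ m + 8) * (δ * 2 ^ i) := by
        refine Finset.sum_le_sum fun i _ => Finset.sum_le_sum fun P hP =>
          Finset.sum_le_sum fun jk _ => ?_
        obtain ⟨h1, h2⟩ := T.mem_clusters_of_mem_pairs hP
        exact T.dist_le_of_mem_pairs hδ hP
          (base_subset h1 (mem_of_mem_sampleSpace hω (base_nonempty h1) _))
          (base_subset h2 (mem_of_mem_sampleSpace hω (base_nonempty h2) _))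
    _ = _ := by
        rw [Finset.mul_sum]
        refine Finset.sum_congr rfl fun i _ => ?_
        simp only [Finset.sum_const, Finset.card_univ, Fintype.card_prod, Fintype.card_fin,
          nsmul_eq_mul]
        push_cast
        ring

end Cost

section Stretch

variable {γ : ℝ} {m M s : ℕ} {ω : Finset X → Fin s → X} {B : Finset X}

theorem pathDist_le_of_mem_edges {a b : {z : X | z ∉ B}}
    (h : s(a.1, b.1) ∈ T.edges γ m M ω) :
    ((T.spanner γ m M ω).induce {z : X | z ∉ B}).pathDist a b ≤ ENNReal.ofReal (dist a.1 b.1) := by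
  by_cases hab : a = b
  · rw [hab, WeightedGraph.pathDist_self]; exact zero_le
  · refine WeightedGraph.pathDist_induce_ofMetric_le _ _ ?_
    rw [SimpleGraph.fromEdgeSet_adj]
    exact ⟨h, fun h => hab (Subtype.ext h)⟩

theorem mem_edges {i : ℕ} (hi : i < M) {P : Finset X × Finset X} (hP : P ∈ T.pairs m i)
    (j k : Fin s) : s(ω (T.base γ P.1) j, ω (T.base γ P.2) k) ∈ T.edges γ m M ω := by
  classical
  exact Finset.mem_biUnion.2 ⟨i, Finset.mem_range.2 hi, Finset.mem_biUnion.2 ⟨P, hP,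
    Finset.mem_image.2 ⟨(j, k), Finset.mem_univ _, rfl⟩⟩⟩

theorem exists_rep_notMem {x : X} (hx : x ∉ T.faulty γ ω B) (i : ℕ) :
    ∃ j, ω (T.base γ (T.cluster i x)) j ∉ B := by
  classical
  by_contra! h
  exact hx (Finset.mem_filter.2 ⟨Finset.mem_univ _, T.cluster i x, T.cluster_mem_clusters i x,
    T.self_mem_cluster i x, h⟩)

open Classical in
theorem rep_mem_cluster (hω : ω ∈ sampleSpace X s) (i : ℕ) (x : X) (j : Fin s) :
    ω (T.base γ (T.cluster i x)) j ∈ T.cluster i x :=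
  base_subset (T.cluster_mem_clusters i x)
    (mem_of_mem_sampleSpace hω (base_nonempty (T.cluster_mem_clusters i x)) j)

open Classical in
theorem subset_faulty (hω : ω ∈ sampleSpace X s) : B ⊆ T.faulty γ ω B := by
  intro b hb
  refine Finset.mem_filter.2 ⟨Finset.mem_univ _, T.cluster 0 b, T.cluster_mem_clusters 0 b,
    T.self_mem_cluster 0 b, fun j => ?_⟩
  have := (Finset.ext_iff.1 (T.cluster_zero b) _).1 (T.rep_mem_cluster (γ := γ) hω 0 b j)
  rw [Finset.mem_singleton.1 this]
  exact hb

-- The climb goes through one unattacked representative per level. With `D = δ * 2 ^ i`, the next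
-- edge joins points of one cluster of level `i + 1` and has length at most `8 * D`, so the bound `8
-- * D` doubles along with the scale.
open Classical in
theorem exists_rep_pathDist_le (hδ : 0 < δ) (hω : ω ∈ sampleSpace X s)
    (hM : ∀ i, 2 ≤ (T.net i).card → i < M) (x : {z : X | z ∉ B}) (hx : x.1 ∉ T.faulty γ ω B)
    (i : ℕ) : ∃ z : {z : X | z ∉ B}, (∃ j, z.1 = ω (T.base γ (T.cluster i x)) j) ∧
      ((T.spanner γ m M ω).induce {z : X | z ∉ B}).pathDist x z ≤
        ENNReal.ofReal (8 * (δ * 2 ^ i)) := by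
  induction i with
  | zero =>
    obtain ⟨j, hj⟩ := T.exists_rep_notMem hx 0
    have hm := (Finset.ext_iff.1 (T.cluster_zero x.1) _).1
      (T.rep_mem_cluster (γ := γ) hω 0 x.1 j)
    refine ⟨x, ⟨j, (Finset.mem_singleton.1 hm).symm⟩, ?_⟩
    rw [WeightedGraph.pathDist_self]; exact zero_le
  | succ i ih =>
    obtain ⟨z, ⟨j, hz⟩, hd⟩ := ih
    have h0 : 0 ≤ δ * 2 ^ i := by positivity
    by_cases hne : T.cluster i x = T.cluster (i + 1) x
    -- A cluster that does not change keeps its base and its samples, so no edge is needed.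
    · refine ⟨z, ⟨j, by rw [← hne]; exact hz⟩, hd.trans (ENNReal.ofReal_le_ofReal ?_)⟩
      rw [pow_succ]; linarith
    · obtain ⟨hP, q, hq, hq'⟩ := T.mem_pairs_of_cluster_ne m hne
      have hi := hM i (T.two_le_card_net_of_notMem (Nat.le_succ i) hq hq')
      obtain ⟨k, hk⟩ := T.exists_rep_notMem hx (i + 1)
      set z' : {z : X | z ∉ B} := ⟨ω (T.base γ (T.cluster (i + 1) x)) k, hk⟩ with hz'
      refine ⟨z', ⟨k, rfl⟩, ?_⟩
      have hedge : s(z.1, z'.1) ∈ T.edges γ m M ω := by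
        rw [hz]; exact T.mem_edges hi hP j k
      have hdist : dist z.1 z'.1 ≤ 4 * (δ * 2 ^ (i + 1)) := by
        refine T.dist_le_of_mem_cluster hδ.le (x := x.1) ?_ (T.rep_mem_cluster hω _ _ _)
        rw [hz]
        exact T.cluster_subset (Nat.le_succ i) _ (T.rep_mem_cluster hω _ _ _)
      refine (WeightedGraph.pathDist_triangle _ x z z').trans ?_
      refine (add_le_add hd (T.pathDist_le_of_mem_edges hedge)).trans ?_
      rw [← ENNReal.ofReal_add (by positivity) dist_nonneg]
      refine ENNReal.ofReal_le_ofReal ?_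
      rw [pow_succ] at *
      linarith

-- At a scale `D` with `24 * D ≤ ε * d`, the two climbs cost `8 * D` each and the crossing edge at
-- most `d + 8 * D`.
open Classical in
theorem pathDist_spanner_le (hδ : 0 < δ) (hω : ω ∈ sampleSpace X s)
    (hM : ∀ i, 2 ≤ (T.net i).card → i < M) {ε : ℝ} (hε : 0 < ε) (hε1 : ε ≤ 1)
    (hm : 48 / ε + 4 ≤ 2 ^ m) (hsep : ∀ x y : X, x ≠ y → 2 ^ m * δ < dist x y)
    (x y : {z : X | z ∉ B}) (hx : x.1 ∉ T.faulty γ ω B) (hy : y.1 ∉ T.faulty γ ω B) :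
    ((T.spanner γ m M ω).induce {z : X | z ∉ B}).pathDist x y ≤
      ENNReal.ofReal ((1 + ε) * dist x.1 y.1) := by
  by_cases hxy : x = y
  · rw [hxy, WeightedGraph.pathDist_self]; exact zero_le
  have hxy' : x.1 ≠ y.1 := fun h => hxy (Subtype.ext h)
  set d := dist x.1 y.1 with hd
  have hdpos : 0 < d := dist_pos.2 hxy'
  have h48 : 48 ≤ 48 / ε := by rw [le_div_iff₀ hε]; linarith
  have hR : 0 < (2 : ℝ) ^ m - 4 := by linarith
  -- The crossing takes place at the first level where the net points above `x` and `y`, at distance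
  -- at most `d + 4 * D`, are within `2 ^ m * D`. Minimality makes `D` as small as `O(ε * d)`.
  have hex : ∃ i : ℕ, d ≤ (2 ^ m - 4) * (δ * 2 ^ i) := by
    obtain ⟨i, hi⟩ := pow_unbounded_of_one_lt (d / ((2 ^ m - 4) * δ)) (one_lt_two (α := ℝ))
    refine ⟨i, ?_⟩
    rw [div_lt_iff₀ (by positivity)] at hi
    linarith
  set i := Nat.find hex with hi
  have hi1 : d ≤ (2 ^ m - 4) * (δ * 2 ^ i) := Nat.find_spec hex
  -- Distances exceed `2 ^ m * δ`, so the search does not stop at level zero and the previous level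
  -- fails.
  have hi0 : i ≠ 0 := by
    intro h0
    rw [h0, pow_zero, mul_one] at hi1
    have := hsep _ _ hxy'
    nlinarith
  have hi2 : (2 ^ m - 4) * (δ * 2 ^ i) < 2 * d := by
    obtain ⟨k, hk⟩ := Nat.exists_eq_succ_of_ne_zero hi0
    have := Nat.find_min hex (m := k) (by rw [← hi, hk]; exact Nat.lt_succ_self k)
    rw [not_le] at this
    rw [hk, Nat.succ_eq_add_one, pow_succ]
    linarith
  set D := δ * 2 ^ i with hD
  have hDpos : 0 < D := by positivity
  have h24 : 24 * D ≤ ε * d := by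
    have h1 : 48 / ε * D ≤ 2 * d := by
      have : 48 / ε * D ≤ (2 ^ m - 4) * D := mul_le_mul_of_nonneg_right (by linarith) hDpos.le
      linarith
    rw [div_mul_eq_mul_div, div_le_iff₀ hε] at h1
    linarith
  have hDd : 24 * D ≤ d := by nlinarith
  have hne : T.anc i x.1 ≠ T.anc i y.1 := by
    intro h
    have := T.dist_le_of_mem_cluster hδ.le (T.mem_cluster.2 h) (T.self_mem_cluster i y.1)
    linarith
  have hnear : dist (T.anc i x.1) (T.anc i y.1) ≤ 2 ^ m * D := by
    have t := dist_triangle4 (T.anc i x.1) x.1 y.1 (T.anc i y.1)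
    have h1 := T.dist_anc_le hδ.le i x.1
    have h2 := T.dist_anc_le hδ.le i y.1
    rw [dist_comm] at h1
    linarith
  have hP := T.mem_pairs_of_anc_ne hne hnear
  have hiM := hM i (T.two_le_card_net (T.anc_mem_net i x.1) (T.anc_mem_net i y.1) hne)
  obtain ⟨z, ⟨j, hz⟩, hzd⟩ := T.exists_rep_pathDist_le (m := m) hδ hω hM x hx i
  obtain ⟨z', ⟨k, hz'⟩, hzd'⟩ := T.exists_rep_pathDist_le (m := m) hδ hω hM y hy i
  have hedge : s(z.1, z'.1) ∈ T.edges γ m M ω := by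
    rw [hz, hz']; exact T.mem_edges hiM hP j k
  have hzz : dist z.1 z'.1 ≤ d + 8 * D := by
    have h1 : dist z.1 x.1 ≤ 4 * D := T.dist_le_of_mem_cluster hδ.le (x := x.1)
      (by rw [hz]; exact T.rep_mem_cluster hω _ _ _) (T.self_mem_cluster i x.1)
    have h2 : dist y.1 z'.1 ≤ 4 * D := T.dist_le_of_mem_cluster hδ.le (x := y.1)
      (T.self_mem_cluster i y.1) (by rw [hz']; exact T.rep_mem_cluster hω _ _ _)
    have t := dist_triangle4 z.1 x.1 y.1 z'.1
    linarith
  rw [WeightedGraph.pathDist_comm] at hzd'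
  refine (WeightedGraph.pathDist_triangle _ x z y).trans ((add_le_add hzd
    ((WeightedGraph.pathDist_triangle _ z z' y).trans
      (add_le_add (T.pathDist_le_of_mem_edges hedge) hzd'))).trans ?_)
  rw [← ENNReal.ofReal_add dist_nonneg (by positivity), ← ENNReal.ofReal_add (by positivity)
    (by positivity)]
  refine ENNReal.ofReal_le_ofReal ?_
  linarith

end Stretch

end NetTree

/-! ### From random samples to a distribution over graphs -/

theorem PMF.tsum_map_mul {α β : Type*} (p : PMF α) (g : α → β) (F : β → ℝ≥0∞) :
    ∑' b, (p.map g) b * F b = ∑' a, p a * F (g a) := by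
  classical
  simp_rw [PMF.map_apply, ← ENNReal.tsum_mul_right]
  rw [ENNReal.tsum_comm]
  refine tsum_congr fun a => ?_
  rw [tsum_eq_single (g a) fun b hb => by rw [if_neg hb, zero_mul], if_pos rfl]

/-- A uniformly random choice from a finite family of graphs is a reliable spanner if faulty
extensions can be found in terms of the choice. -/
theorem isObliviousReliableSpanner_map {X ι : Type*} [MetricSpace X] [Fintype X]
    (Ω : Finset ι) (hΩ : Ω.Nonempty) (g : ι → WeightedGraph X) {ν t : ℝ}
    (hdom : ∀ ω ∈ Ω, (g ω).Dominates)
    (h : ∀ B : Finset X, ∃ Bp : ι → Finset X, (∀ ω ∈ Ω, B ⊆ Bp ω ∧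
      ∀ x y : {z : X | z ∉ B}, x.1 ∉ Bp ω → y.1 ∉ Bp ω →
        ((g ω).induce {z : X | z ∉ B}).pathDist x y ≤ ENNReal.ofReal (t * dist x.1 y.1)) ∧
      ∑ ω ∈ Ω, ((Bp ω).card : ℝ) ≤ (1 + ν) * B.card * Ω.card) :
    IsObliviousReliableSpanner ((PMF.uniformOfFinset Ω hΩ).map g) ν t := by
  classical
  have hsupp : ∀ H ∈ ((PMF.uniformOfFinset Ω hΩ).map g).support, ∃ ω ∈ Ω, g ω = H := by
    intro H hH
    rw [PMF.support_map, PMF.support_uniformOfFinset] at hH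
    exact hH
  refine ⟨fun H hH => ?_, fun B => ?_⟩
  · obtain ⟨ω, hω, rfl⟩ := hsupp H hH
    exact hdom ω hω
  · obtain ⟨Bp, hBp, hsum⟩ := h B
    -- Different samples may give the same graph, but the extension may depend on the graph only.
    -- The smallest one among the samples giving `H` does not increase the average.
    have hbest : ∀ H, ∃ ω, (∃ ω' ∈ Ω, g ω' = H) →
        ω ∈ Ω ∧ g ω = H ∧ ∀ ω' ∈ Ω, g ω' = H → (Bp ω).card ≤ (Bp ω').card := by
      intro H
      by_cases hH : ∃ ω' ∈ Ω, g ω' = H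
      · obtain ⟨ω', hω', hg⟩ := hH
        obtain ⟨ω, hω, hmin⟩ := Finset.exists_min_image (Ω.filter fun ω => g ω = H)
          (fun ω => (Bp ω).card) ⟨ω', Finset.mem_filter.2 ⟨hω', hg⟩⟩
        obtain ⟨h1, h2⟩ := Finset.mem_filter.1 hω
        exact ⟨ω, fun _ => ⟨h1, h2, fun ω' h3 h4 => hmin ω' (Finset.mem_filter.2 ⟨h3, h4⟩)⟩⟩
      · exact ⟨hΩ.choose, fun h => absurd h hH⟩
    choose best hbest using hbest
    refine ⟨fun H => Bp (best H), fun H hH => ?_, ?_⟩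
    · obtain ⟨h1, h2, -⟩ := hbest H (hsupp H hH)
      have := hBp _ h1
      rw [h2] at this
      exact this
    · rw [PMF.tsum_map_mul _ g fun H => ((Bp (best H)).card : ℝ≥0∞),
        tsum_eq_sum (s := Ω) fun ω hω => by
          rw [PMF.uniformOfFinset_apply_of_notMem _ hω, zero_mul]]
      have hc : (0 : ℝ) < Ω.card := by exact_mod_cast hΩ.card_pos
      calc _ ≤ ∑ ω ∈ Ω, (Ω.card : ℝ≥0∞)⁻¹ * ((Bp ω).card : ℝ≥0∞) := by
            refine Finset.sum_le_sum fun ω hω => ?_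
            rw [PMF.uniformOfFinset_apply_of_mem _ hω]
            refine mul_le_mul_right ?_ _
            exact_mod_cast (hbest (g ω) ⟨ω, hω, rfl⟩).2.2 ω hω rfl
        _ = ENNReal.ofReal ((Ω.card : ℝ)⁻¹ * ∑ ω ∈ Ω, ((Bp ω).card : ℝ)) := by
            rw [← Finset.mul_sum, ENNReal.ofReal_mul (by positivity),
              ENNReal.ofReal_inv_of_pos hc, ENNReal.ofReal_natCast,
              ENNReal.ofReal_sum_of_nonneg fun _ _ => Nat.cast_nonneg _]
            simp
        _ ≤ _ := by
            refine ENNReal.ofReal_le_ofReal ?_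
            rw [inv_mul_le_iff₀ hc, mul_comm]
            exact hsum

/-! ### Numerical estimates -/

section Estimates

variable {ν : ℝ} {n : ℕ}

theorem three_halves_le_logb (hn : 3 ≤ n) : 3 / 2 ≤ Real.logb 2 n := by
  have hn' : (3 : ℝ) ≤ n := by exact_mod_cast hn
  rw [Real.le_logb_iff_rpow_le (by norm_num) (by linarith)]
  refine le_trans ?_ hn'
  have h : ((2 : ℝ) ^ (3 / 2 : ℝ)) ^ 2 = 8 := by
    rw [← Real.rpow_natCast, ← Real.rpow_mul (by norm_num)]; norm_num
  have h0 : (0 : ℝ) ≤ (2 : ℝ) ^ (3 / 2 : ℝ) := by positivity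
  nlinarith

theorem half_le_logb_logb (hn : 3 ≤ n) : 1 / 2 ≤ Real.logb 2 (Real.logb 2 n) := by
  have h := three_halves_le_logb hn
  rw [Real.le_logb_iff_rpow_le (by norm_num) (by linarith)]
  refine le_trans ?_ h
  have h2 : ((2 : ℝ) ^ (1 / 2 : ℝ)) ^ 2 = 2 := by
    rw [← Real.rpow_natCast, ← Real.rpow_mul (by norm_num)]; norm_num
  have h0 : (0 : ℝ) ≤ (2 : ℝ) ^ (1 / 2 : ℝ) := by positivity
  nlinarith

theorem four_le_logb_inv (hν : 0 < ν) (hν' : ν < 1 / 16) : 4 ≤ Real.logb 2 ν⁻¹ := by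
  rw [Real.le_logb_iff_rpow_le (by norm_num) (by positivity), le_inv_comm₀ (by positivity) hν]
  norm_num
  linarith

theorem sizeClass_add_one_le (hν : 0 < ν) (hν' : ν < 1 / 16) (hn : 3 ≤ n) :
    (sizeClass (ν / 8) n + 1 : ℝ) ≤ 17 * Real.logb 2 n * ν⁻¹ := by
  have hl := three_halves_le_logb hn
  have hn' : (3 : ℝ) ≤ n := by exact_mod_cast hn
  have hlog : ν / 16 ≤ Real.log (1 + ν / 8) := by
    refine le_trans ?_ (Real.one_sub_inv_le_log_of_pos (by linarith))
    rw [le_sub_comm, inv_le_comm₀ (by linarith) (by linarith), inv_le_iff_one_le_mul₀ (by linarith)]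
    nlinarith
  have hln : Real.log n ≤ Real.logb 2 n := by
    rw [Real.logb, le_div_iff₀ (Real.log_pos (by norm_num))]
    have h2 : Real.log 2 ≤ 1 := by linarith [Real.log_two_lt_d9]
    have h3 : 0 ≤ Real.log n := Real.log_nonneg (by linarith)
    nlinarith
  have hlpos : 0 < Real.log (1 + ν / 8) := lt_of_lt_of_le (by positivity) hlog
  have h1 : (sizeClass (ν / 8) n : ℝ) ≤ Real.log n / Real.log (1 + ν / 8) :=
    Nat.floor_le (div_nonneg (Real.log_nonneg (by linarith)) hlpos.le)
  have h2 : Real.log n / Real.log (1 + ν / 8) ≤ Real.logb 2 n / (ν / 16) :=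
    div_le_div₀ (by linarith) hln (by positivity) hlog
  have h3 : Real.logb 2 n / (ν / 16) = 16 * Real.logb 2 n * ν⁻¹ := by field_simp
  have h4 : 1 ≤ ν⁻¹ := by rw [one_le_inv₀ hν]; linarith
  nlinarith

/-- The number of samples per cluster. -/
noncomputable def sampleCount (ν : ℝ) (n : ℕ) : ℕ :=
  ⌈8 * ν⁻¹ * Real.log (68 * Real.logb 2 n * ν⁻¹ ^ 2)⌉₊

/-- Dense points cost `ν / 2` beyond `|B|`. The number of samples is chosen to make `(1 - ν / 8) ^
s` at most `1 / (68 * log n * ν⁻¹ ^ 2)`, and against about `17 * log n * ν⁻¹` bases at a point this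
leaves the other `ν / 2`. -/
theorem failure_le (hν : 0 < ν) (hν' : ν < 1 / 16) (hn : 3 ≤ n) :
    1 / (1 - 2 * (ν / 8)) + (1 + ν / 8) * (1 - ν / 8) ^ sampleCount ν n *
      (sizeClass (ν / 8) n + 1) ≤ 1 + ν := by
  have hl := three_halves_le_logb hn
  have hL := sizeClass_add_one_le hν hν' hn
  set a := 68 * Real.logb 2 n * ν⁻¹ ^ 2 with ha
  have hapos : 0 < a := by positivity
  have h1 : 1 / (1 - 2 * (ν / 8)) ≤ 1 + ν / 2 := by
    rw [div_le_iff₀ (by linarith)]; nlinarith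
  have h2 : (1 - ν / 8) ^ sampleCount ν n ≤ a⁻¹ := by
    calc (1 - ν / 8) ^ sampleCount ν n ≤ (Real.exp (-(ν / 8))) ^ sampleCount ν n :=
          pow_le_pow_left₀ (by linarith) (by linarith [Real.add_one_le_exp (-(ν / 8))]) _
      _ = Real.exp (-(ν / 8 * sampleCount ν n)) := by
          rw [← Real.exp_nat_mul]; congr 1; ring
      _ ≤ Real.exp (-Real.log a) := by
          rw [Real.exp_le_exp, neg_le_neg_iff]
          have : 8 * ν⁻¹ * Real.log a ≤ sampleCount ν n := Nat.le_ceil _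
          calc Real.log a = ν / 8 * (8 * ν⁻¹ * Real.log a) := by field_simp
            _ ≤ _ := by gcongr
      _ = a⁻¹ := by rw [Real.exp_neg, Real.exp_log hapos]
  have h3 : (1 + ν / 8) * (1 - ν / 8) ^ sampleCount ν n * (sizeClass (ν / 8) n + 1) ≤
      2 * a⁻¹ * (17 * Real.logb 2 n * ν⁻¹) := by
    have : 0 ≤ (1 - ν / 8) ^ sampleCount ν n := pow_nonneg (by linarith) _
    gcongr
    linarith
  have h4 : 2 * a⁻¹ * (17 * Real.logb 2 n * ν⁻¹) = ν / 2 := by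
    rw [ha]
    have : Real.logb 2 n ≠ 0 := by linarith
    field_simp
    norm_num
  linarith

theorem sampleCount_add_one_le (hν : 0 < ν) (hν' : ν < 1 / 16) (hn : 3 ≤ n) :
    (sampleCount ν n + 1 : ℝ) ≤
      ν⁻¹ * (33 * Real.logb 2 ν⁻¹ + 8 * Real.logb 2 (Real.logb 2 n)) := by
  have hl := three_halves_le_logb hn
  have hv := half_le_logb_logb hn
  have hu := four_le_logb_inv hν hν'
  set u := Real.logb 2 ν⁻¹ with hudef
  set v := Real.logb 2 (Real.logb 2 n) with hvdef
  set a := 68 * Real.logb 2 n * ν⁻¹ ^ 2 with ha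
  have hi : 16 ≤ ν⁻¹ := by rw [le_inv_comm₀ (by norm_num) hν]; linarith
  have ha1 : 1 ≤ a := by rw [ha]; nlinarith [sq_nonneg (ν⁻¹ - 1)]
  have h1 : Real.logb 2 a ≤ 7 + v + 2 * u := by
    rw [ha, Real.logb_mul (by positivity) (by positivity), Real.logb_mul (by norm_num) (by linarith),
      Real.logb_pow, ← hudef, ← hvdef]
    have : Real.logb 2 68 ≤ 7 := by
      rw [Real.logb_le_iff_le_rpow (by norm_num) (by norm_num)]; norm_num
    push_cast
    linarith
  have h2 : Real.log a ≤ Real.logb 2 a := by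
    rw [Real.logb, le_div_iff₀ (Real.log_pos (by norm_num))]
    have h2 : Real.log 2 ≤ 1 := by linarith [Real.log_two_lt_d9]
    have h3 : 0 ≤ Real.log a := Real.log_nonneg ha1
    nlinarith
  have h3 : (sampleCount ν n : ℝ) < 8 * ν⁻¹ * Real.log a + 1 :=
    Nat.ceil_lt_add_one (by have := Real.log_nonneg ha1; positivity)
  have h4 : 8 * ν⁻¹ * Real.log a ≤ 8 * ν⁻¹ * (4 * u + v) := by gcongr; linarith
  nlinarith

theorem le_softO {C x k : ℝ} (p : ℝ) (hk : k ≤ C) (hp : p ≤ C) (hx : 0 ≤ x)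
    (hl : 1 ≤ Real.logb 2 x) (hk0 : 0 ≤ k) : k * x * (Real.logb 2 x) ^ p ≤ softO C x := by
  unfold softO
  have : (Real.logb 2 x) ^ p ≤ (Real.logb 2 x) ^ C := Real.rpow_le_rpow_of_exponent_le hl hp
  have h0 : 0 ≤ (Real.logb 2 x) ^ p := Real.rpow_nonneg (by linarith) _
  have hC : 0 ≤ C := hk0.trans hk
  gcongr

theorem sampleCount_le_softO (hν : 0 < ν) (hν' : ν < 1 / 16) (hn : 3 ≤ n) {C : ℝ} (hC : 91 ≤ C) :
    (sampleCount ν n + 1 : ℝ) ≤ softO C (ν⁻¹ * Real.logb 2 (Real.logb 2 n)) := by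
  have hv := half_le_logb_logb hn
  have hu := four_le_logb_inv hν hν'
  have hs := sampleCount_add_one_le hν hν' hn
  set u := Real.logb 2 ν⁻¹ with hudef
  set v := Real.logb 2 (Real.logb 2 n) with hvdef
  have hlv : -1 ≤ Real.logb 2 v := by
    rw [Real.le_logb_iff_rpow_le (by norm_num) (by linarith), Real.rpow_neg_one]
    linarith
  have hlog : Real.logb 2 (ν⁻¹ * v) = u + Real.logb 2 v := by
    rw [Real.logb_mul (by positivity) (by linarith)]
  refine le_trans ?_ (le_softO 1 hC (by linarith) (by positivity) (by rw [hlog]; linarith)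
    (by norm_num))
  rw [Real.rpow_one, hlog]
  have hi : 0 < ν⁻¹ := by positivity
  refine hs.trans ?_
  -- As `v ≥ 1 / 2` and `u ≥ 4`, the left side is at most `68 * u * v`, while `u + logb 2 v ≥ u - 1
  -- ≥ 3 / 4 * u`; hence the constant `91`.
  have : 33 * u + 8 * v ≤ 91 * v * (u + Real.logb 2 v) := by nlinarith
  calc ν⁻¹ * (33 * u + 8 * v) ≤ ν⁻¹ * (91 * v * (u + Real.logb 2 v)) := by gcongr
    _ = _ := by ring

theorem sampleCount_sq_le_softO (hν : 0 < ν) (hν' : ν < 1 / 16) (hn : 3 ≤ n) {C : ℝ}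
    (hC : 6936 ≤ C) :
    24 * Real.logb 2 n * (sampleCount ν n + 1 : ℝ) ^ 2 ≤ softO C (ν⁻¹ ^ 2 * Real.logb 2 n) := by
  have hl := three_halves_le_logb hn
  have hv := half_le_logb_logb hn
  have hu := four_le_logb_inv hν hν'
  have hs := sampleCount_add_one_le hν hν' hn
  have hlog : Real.logb 2 (ν⁻¹ ^ 2 * Real.logb 2 n) =
      2 * Real.logb 2 ν⁻¹ + Real.logb 2 (Real.logb 2 n) := by
    rw [Real.logb_mul (by positivity) (by linarith), Real.logb_pow]; push_cast; ring
  set u := Real.logb 2 ν⁻¹ with hudef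
  set v := Real.logb 2 (Real.logb 2 n) with hvdef
  refine le_trans ?_ (le_softO 2 hC (by linarith) (by positivity) (by rw [hlog]; linarith)
    (by norm_num))
  rw [hlog, show ((2 : ℝ) : ℝ) = ((2 : ℕ) : ℝ) by norm_num, Real.rpow_natCast]
  have hi : 0 < ν⁻¹ := by positivity
  -- The factor `17` is squared below, and `24 * 17 ^ 2 = 6936` is the final constant.
  have h1 : (sampleCount ν n + 1 : ℝ) ≤ ν⁻¹ * (17 * (2 * u + v)) :=
    hs.trans (by gcongr; linarith)
  calc 24 * Real.logb 2 n * (sampleCount ν n + 1 : ℝ) ^ 2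
      ≤ 24 * Real.logb 2 n * (ν⁻¹ * (17 * (2 * u + v))) ^ 2 := by gcongr
    _ = _ := by push_cast; ring

end Estimates

/-! ### Assembling the construction -/

theorem exists_pos_mul_lt_dist (X : Type*) [MetricSpace X] [Fintype X] {c : ℝ} (hc : 0 < c) :
    ∃ δ : ℝ, 0 < δ ∧ ∀ x y : X, x ≠ y → c * δ < dist x y := by
  classical
  by_cases hne : (Finset.univ.filter fun p : X × X => p.1 ≠ p.2).Nonempty
  · obtain ⟨⟨a, b⟩, hab, hmin⟩ := Finset.exists_min_image _ (fun p : X × X => dist p.1 p.2) hne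
    simp only [Finset.mem_filter, Finset.mem_univ, true_and, Prod.forall] at hab hmin
    have hpos := dist_pos.2 hab
    refine ⟨dist a b / (2 * c), by positivity, fun x y hxy => ?_⟩
    have : c * (dist a b / (2 * c)) = dist a b / 2 := by field_simp
    rw [this]
    linarith [hmin x y hxy]
  · refine ⟨1, one_pos, fun x y hxy => ?_⟩
    exact absurd ⟨(x, y), by simpa using hxy⟩ hne

open Classical in
/-- Random net-tree spanners: their reliability, size and lightness in terms of the number of
samples and of the parameter `m`. -/
theorem exists_reliable_spanner {X : Type*} [MetricSpace X] [Fintype X] {ε ν ddim : ℝ} {n m l : ℕ}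
    (hε : 0 < ε) (hε' : ε ≤ 1) (hν : 0 < ν) (hν' : ν < 1 / 16) (hcard : Fintype.card X = n)
    (hn : 3 ≤ n) (hd : HasDoublingDimension X ddim) (hm : 1 ≤ m) (hmε : 48 / ε + 4 ≤ 2 ^ m)
    (hl : n ≤ 2 ^ l) :
    ∃ D : PMF (WeightedGraph X), IsObliviousReliableSpanner D ν (1 + ε) ∧
      HasSizeAtMost D ((sampleCount ν n + 1 : ℝ) ^ 2 *
        (4 * ((2 : ℝ) ^ ddim) ^ (m + 1) * (m * n))) ∧
      HasLightnessAtMost D ((sampleCount ν n + 1 : ℝ) ^ 2 * (2 ^ m + 8) *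
        (4 * ((2 : ℝ) ^ ddim) ^ (m + 1) * (2 * (l + 1)))) := by
  have : Nonempty X := Fintype.card_pos_iff.1 (by omega)
  have hddim := hd.one_le (by omega)
  -- The finest scale lies a factor `2 ^ m` below all distances, so that even the closest pair has a
  -- suitable crossing level.
  obtain ⟨δ, hδ, hsep⟩ := exists_pos_mul_lt_dist X (c := 2 ^ m) (by positivity)
  have hsep' : ∀ x y : X, x ≠ y → δ < dist x y := fun x y hxy =>
    lt_of_le_of_lt (le_mul_of_one_le_left hδ.le (one_le_pow₀ (by norm_num))) (hsep x y hxy)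
  obtain ⟨T⟩ := NetTree.exists hδ hsep'
  set W := mstWeight X with hW
  have hWpos : 0 < W := mstWeight_pos X (by omega)
  -- A net with two points has scale at most the weight of a minimum spanning tree, so all levels
  -- from the first larger scale on are trivial.
  have hex : ∃ M : ℕ, W < δ * 2 ^ M := by
    obtain ⟨M, hM⟩ := pow_unbounded_of_one_lt (W / δ) (one_lt_two (α := ℝ))
    exact ⟨M, by rw [div_lt_iff₀ hδ] at hM; linarith⟩
  set M := Nat.find hex with hMdef
  have hM1 : ∀ i < M, δ * 2 ^ i ≤ W := fun i hi => not_lt.1 (Nat.find_min hex hi)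
  have hM : ∀ i, 2 ≤ (T.net i).card → i < M := by
    intro i hi
    by_contra! hMi
    have h1 := T.scale_le_mstWeight hδ.le hi
    have h2 : δ * 2 ^ M ≤ δ * 2 ^ i := by gcongr; norm_num
    linarith [Nat.find_spec hex]
  set s := sampleCount ν n with hs
  set Ω := sampleSpace X (s + 1) with hΩ
  have hΩne : Ω.Nonempty := sampleSpace_nonempty
  set g : (Finset X → Fin (s + 1) → X) → WeightedGraph X := fun ω => T.spanner (ν / 8) m M ω
  have hsupp : ∀ H ∈ ((PMF.uniformOfFinset Ω hΩne).map g).support, ∃ ω ∈ Ω, g ω = H := by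
    intro H hH
    rw [PMF.support_map, PMF.support_uniformOfFinset] at hH
    exact hH
  have hpairs := fun i => T.card_pairs_le hδ hd hddim hm i
  set Q := 4 * ((2 : ℝ) ^ ddim) ^ (m + 1) with hQ
  have hQ0 : 0 ≤ Q := by positivity
  refine ⟨(PMF.uniformOfFinset Ω hΩne).map g, ?_, ?_, ?_⟩
  · refine isObliviousReliableSpanner_map Ω hΩne g
      (fun ω _ => WeightedGraph.ofMetric_dominates _) fun B => ?_
    refine ⟨fun ω => T.faulty (ν / 8) ω B, fun ω hω => ⟨T.subset_faulty hω, fun x y hx hy =>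
      T.pathDist_spanner_le hδ hω hM hε hε' hmε hsep x y hx hy⟩, ?_⟩
    refine (T.sum_card_faulty_le (by positivity) (by linarith) s B).trans ?_
    rw [hcard]
    have := failure_le hν hν' hn
    gcongr
  · intro H hH
    obtain ⟨ω, hω, rfl⟩ := hsupp H hH
    have h1 : ((g ω).size : ℝ) ≤ ((s + 1 : ℕ) : ℝ) ^ 2 *
        ∑ i ∈ Finset.range M, ((T.pairs m i).card : ℝ) := by
      exact_mod_cast T.size_spanner_le (ν / 8) m M ω
    refine h1.trans ?_
    push_cast
    gcongr
    calc ∑ i ∈ Finset.range M, ((T.pairs m i).card : ℝ)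
        ≤ ∑ i ∈ Finset.range M, Q * (T.net i \ T.net (i + m)).card :=
          Finset.sum_le_sum fun i _ => hpairs i
      _ = Q * ((∑ i ∈ Finset.range M, (T.net i \ T.net (i + m)).card : ℕ) : ℝ) := by
          rw [← Finset.mul_sum]; push_cast; rfl
      _ ≤ Q * (m * n) := by
          gcongr
          rw [← hcard]
          exact_mod_cast T.sum_card_net_sdiff_le m M
  · intro H hH
    obtain ⟨ω, hω, rfl⟩ := hsupp H hH
    rw [WeightedGraph.lightness, div_le_iff₀ hWpos]
    refine (T.totalWeight_spanner_le (ν / 8) m M hδ.le hω).trans ?_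
    push_cast
    rw [mul_assoc ((s + 1 : ℝ) ^ 2 * (2 ^ m + 8))]
    gcongr
    have hgeo : ∑ i ∈ Finset.range M, ((T.net i \ T.net (i + m)).card * (δ * 2 ^ i) : ℝ) ≤
        2 * W * (l + 1) := by
      refine sum_le_of_le_geometric _ hδ.le n M l hWpos.le ?_ ?_ hM1 hl
      · intro i _
        rcases Finset.eq_empty_or_nonempty (T.net i \ T.net (i + m)) with h0 | ⟨q, hq⟩
        · rw [h0]; simp; exact hWpos.le
        · obtain ⟨hq1, hq2⟩ := Finset.mem_sdiff.1 hq
          refine le_trans ?_ (T.card_net_mul_le hδ.le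
            (T.two_le_card_net_of_notMem (Nat.le_add_right i m) hq1 hq2))
          gcongr
          exact Finset.sdiff_subset
      · intro i _
        gcongr
        rw [← hcard]
        exact Finset.card_le_univ _
    calc ∑ i ∈ Finset.range M, ((T.pairs m i).card * (δ * 2 ^ i) : ℝ)
        ≤ ∑ i ∈ Finset.range M, Q * ((T.net i \ T.net (i + m)).card * (δ * 2 ^ i)) := by
          refine Finset.sum_le_sum fun i _ => ?_
          rw [← mul_assoc Q]
          exact mul_le_mul_of_nonneg_right (hpairs i) (by positivity)
      _ = Q * ∑ i ∈ Finset.range M, ((T.net i \ T.net (i + m)).card * (δ * 2 ^ i) : ℝ) := by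
          rw [Finset.mul_sum]
      _ ≤ Q * (2 * W * (l + 1)) := by gcongr
      _ = _ := by ring

/-- The net parameter for the stretch `1 + ε`. -/
theorem exists_net_parameter {ε : ℝ} (hε : 0 < ε) (hε' : ε < 1 / 16) :
    ∃ m : ℕ, 1 ≤ m ∧ 48 / ε + 4 ≤ 2 ^ m ∧ (2 : ℝ) ^ m ≤ 98 / ε := by
  have h1 : 16 < 1 / ε := by rw [lt_div_iff₀ hε]; linarith
  have e1 : 48 / ε = 48 * (1 / ε) := by ring
  have e2 : 49 / ε = 49 * (1 / ε) := by ring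
  have e3 : 98 / ε = 98 * (1 / ε) := by ring
  -- Since `1 / ε > 16`, the value `49 / ε` leaves room for the summand `4`; rounding up to a power
  -- of two at most doubles it.
  obtain ⟨k, hk1, hk2⟩ := exists_nat_pow_near (x := 49 / ε) (y := (2 : ℝ)) (by linarith)
    (by norm_num)
  refine ⟨k + 1, by omega, by linarith, ?_⟩
  rw [pow_succ]
  linarith

/-- The dependence on `ε` of all constants is absorbed in a power of `ε ^ (-ddim)`. -/
theorem net_constants_le {ε ddim : ℝ} (hε : 0 < ε) (hε' : ε < 1 / 16) (hd : 1 ≤ ddim) {m : ℕ}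
    (hm : (2 : ℝ) ^ m ≤ 98 / ε) :
    ((2 : ℝ) ^ ddim) ^ (m + 1) ≤ ε ^ (-(3 * ddim)) ∧ (2 : ℝ) ^ m + 8 ≤ ε ^ (-(3 * ddim)) ∧
      4 ≤ ε ^ (-(3 * ddim)) := by
  have h1 : 16 < 1 / ε := by rw [lt_div_iff₀ hε]; linarith
  have e3 : 98 / ε = 98 * (1 / ε) := by ring
  have hcube : ε ^ (-(3 * ddim)) = ((1 / ε) ^ 3) ^ ddim := by
    rw [one_div, ← Real.rpow_natCast, ← Real.rpow_mul (by positivity), Real.inv_rpow hε.le,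
      Real.rpow_neg hε.le]
    norm_num
  -- This is `196 / ε ≤ (1 / ε) ^ 3`, as `1 / ε > 16`.
  have hbig : 2 ^ (m + 1) ≤ (1 / ε) ^ 3 := by
    rw [pow_succ]
    nlinarith [sq_nonneg (1 / ε)]
  have hle : (1 / ε) ^ 3 ≤ ((1 / ε) ^ 3) ^ ddim :=
    Real.self_le_rpow_of_one_le (one_le_pow₀ (by linarith)) hd
  rw [hcube]
  refine ⟨?_, ?_, ?_⟩
  · rw [← Real.rpow_natCast, ← Real.rpow_mul (by norm_num), mul_comm, Real.rpow_mul (by norm_num),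
      Real.rpow_natCast]
    exact Real.rpow_le_rpow (by positivity) hbig (by linarith)
  · refine le_trans ?_ hle
    nlinarith [sq_nonneg (1 / ε)]
  · refine le_trans ?_ hle
    nlinarith [sq_nonneg (1 / ε)]

theorem exists_light_reliable_spanner {X : Type*} [MetricSpace X] [Fintype X] {ε ν ddim C : ℝ}
    {n : ℕ} (hε : 0 < ε) (hε' : ε < 1 / 16) (hν : 0 < ν) (hν' : ν < 1 / 16)
    (hcard : Fintype.card X = n) (hn : 3 ≤ n) (hd : HasDoublingDimension X ddim)
    (hC : 6936 ≤ C) :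
    ∃ D : PMF (WeightedGraph X), IsObliviousReliableSpanner D ν (1 + ε) ∧
      HasSizeAtMost D
        (n * ε ^ (-(C * ddim)) * (softO C (ν⁻¹ * Real.logb 2 (Real.logb 2 n))) ^ 2) ∧
      HasLightnessAtMost D (ε ^ (-(C * ddim)) * softO C (ν⁻¹ ^ 2 * Real.logb 2 n)) := by
  have hddim := hd.one_le (by omega)
  obtain ⟨m, hm1, hm2, hm3⟩ := exists_net_parameter hε hε'
  obtain ⟨hQ, hm8, hE⟩ := net_constants_le hε hε' hddim hm3
  have hlog := three_halves_le_logb hn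
  set l := ⌈Real.logb 2 n⌉₊ with hl
  have hln : n ≤ 2 ^ l := by
    have h : Real.logb 2 n ≤ l := Nat.le_ceil _
    rw [Real.logb_le_iff_le_rpow (by norm_num) (by exact_mod_cast (by omega : 0 < n)),
      Real.rpow_natCast] at h
    exact_mod_cast h
  have hl3 : (l + 1 : ℝ) ≤ 3 * Real.logb 2 n := by
    have : (l : ℝ) < Real.logb 2 n + 1 := Nat.ceil_lt_add_one (by linarith)
    linarith
  obtain ⟨D, hD, hsize, hlight⟩ := exists_reliable_spanner hε (by linarith) hν hν' hcard hn hd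
    hm1 hm2 hln
  set Q := ((2 : ℝ) ^ ddim) ^ (m + 1) with hQdef
  set E := ε ^ (-(3 * ddim)) with hEdef
  -- Both costs contain three factors bounded by `E`: `4`, `Q` and `m` in the size; `4`, `Q` and `2
  -- ^ m + 8` in the lightness. The total exponent is `9 * ddim`.
  have hE3 : E ^ 3 ≤ ε ^ (-(C * ddim)) := by
    rw [hEdef, ← Real.rpow_natCast, ← Real.rpow_mul hε.le]
    refine Real.rpow_le_rpow_of_exponent_ge hε (by linarith) ?_
    push_cast
    nlinarith
  have hQ0 : 0 ≤ Q := by positivity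
  have hmE : (m : ℝ) ≤ E := by
    have : (m : ℝ) < 2 ^ m := by exact_mod_cast Nat.lt_two_pow_self
    linarith
  refine ⟨D, hD, fun H hH => (hsize H hH).trans ?_, fun H hH => (hlight H hH).trans ?_⟩
  · have hs := sampleCount_le_softO hν hν' hn (C := C) (by linarith)
    calc _ ≤ (softO C (ν⁻¹ * Real.logb 2 (Real.logb 2 n))) ^ 2 * (E * E * (E * n)) := by gcongr
      _ = n * E ^ 3 * (softO C (ν⁻¹ * Real.logb 2 (Real.logb 2 n))) ^ 2 := by ring
      _ ≤ _ := by gcongr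
  · have hs := sampleCount_sq_le_softO hν hν' hn hC
    have hE0 : 0 ≤ E := by linarith
    calc _ ≤ (sampleCount ν n + 1 : ℝ) ^ 2 * E * (E * E * (2 * (3 * Real.logb 2 n))) := by gcongr
      _ = E ^ 3 * (6 * Real.logb 2 n * (sampleCount ν n + 1 : ℝ) ^ 2) := by ring
      _ ≤ E ^ 3 * (24 * Real.logb 2 n * (sampleCount ν n + 1 : ℝ) ^ 2) := by gcongr; norm_num
      _ ≤ ε ^ (-(C * ddim)) * softO C (ν⁻¹ ^ 2 * Real.logb 2 n) := by gcongr

theorem mainTheorem2 :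
    -- the construction
    (∃ C : ℝ, 0 < C ∧
      ∀ ε ∈ Set.Ioo (0 : ℝ) (1 / 16), ∀ ν ∈ Set.Ioo (0 : ℝ) (1 / 16),
      ∀ (X : Type*) [MetricSpace X] [Fintype X] (n : ℕ) (ddim : ℝ),
        Fintype.card X = n → 3 ≤ n → HasDoublingDimension X ddim →
        ∃ D : PMF (WeightedGraph X),
          IsObliviousReliableSpanner D ν (1 + ε) ∧
          HasSizeAtMost D
            (n * ε ^ (-(C * ddim)) * (softO C (ν⁻¹ * Real.logb 2 (Real.logb 2 n))) ^ 2) ∧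
          HasLightnessAtMost D (ε ^ (-(C * ddim)) * softO C (ν⁻¹ ^ 2 * Real.logb 2 n))) ∧
    -- tightness of the lightness, on the unweighted paths, whose doubling dimension is bounded
    (∀ n : ℕ, HasDoublingDimension (PathMetric n) (Real.logb 2 3)) ∧
    (∃ c : ℝ, 0 < c ∧
      ∀ ν ∈ Set.Ioo (0 : ℝ) (1 / 16), ∀ n : ℕ, 2 ≤ n →
      ∀ (t : ℝ) (D : PMF (WeightedGraph (PathMetric n))),
        IsObliviousReliableSpanner D ν t →
        ∀ φ : ℝ, HasLightnessAtMost D φ → c * (ν⁻¹ ^ 2 * Real.logb 2 (ν * n)) ≤ φ) := by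
  refine ⟨⟨6936, by norm_num, ?_⟩, PathMetric.hasDoublingDimension, 1 / 8192, by norm_num, ?_⟩
  · intro ε hε ν hν X _ _ n ddim hcard hn hd
    exact exists_light_reliable_spanner hε.1 hε.2 hν.1 hν.2 hcard hn hd le_rfl
  · intro ν hν n hn t D hD φ hφ
    exact PathMetric.le_lightness hν.1 hν.2 hn D hD hφ
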